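/- **Problem.** An instance of the Reward-Penalty-Selection Problem (RPSP) consists of a finite set $N=\{1,\dots,N_0\}$ of players, reward sets $A_1,\dots,A_h\subseteq N$ with rewards $a_i\in\mathbb{R}_{\ge 0}$, and penalty sets $B_1,\dots,B_l\subseteq N$ with penalties $b_j\in\mathbb{R}_{\ge 0}$. To solve it is to find a selection $X\subseteq N$ that maximizes $$p(X)=\sum_{i:\,A_i\cap X\neq\emptyset} a_i-\sum_{j:\,B_j\subseteq X} b_j ,$$ together with the value $p(X)$. The instance is *laminar* if the $A_i$ are pairwise distinct, the $B_j$ are pairwise distinct, and any two of the sets $A_1,\dots,A_h,B_1,\dots,B_l$ are disjoint or one contains the other. **Containment graph.** The directed graph $G$ has one node $u_S$ for each reward set and for each penalty set $S$ (two nodes if a reward set equals a penalty set) and, if no set of the instance contains all the others, one further node, the root, which belongs to the set $N$. There is an edge from $u_S$ to $u_{S'}$, for two different nodes, if $S'\subseteq S$. Let $n$ be the number of nodes and $m$ the number of edges of $G$. **Machine model.** Programs run on a real random access machine: the memory consists of arrays of natural numbers and of real numbers, initially zero outside the input; the operations are array access at computed indices, addition, subtraction and comparison, at unit cost. An instance is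 stored with $N_0$, $h$, $l$, the rewards and penalties, and, for each set, its cardinality, a list of its elements and its characteristic vector. The output is a list of the elements of an optimal $X$, with $|X|$ and $p(X)$. **Flow computation.** Let $T_{MF}:\mathbb{N}\times\mathbb{N}\to\{1,2,\dots\}$ be such that some program on this machine computes, in at most $T_{MF}(n,m)$ steps for every network with $n$ nodes, $m$ edges and capacities in $\mathbb{N}\cup\{\infty\}$ for which an optimum exists, an integral maximum $s$-$t$-flow; or, alternatively, such that this holds for integral maximum-profit circulations (with real profits per unit of flow on the edges) in place of maximum flows. **Theorem.** For every such $T_{MF}$, the laminar RPSP can be solved in time $\mathcal{O}\bigl(m(n+m)+T_{MF}(n,m)\bigr)$: there are a program and a constant $C$ such that the program, started on any laminar instance, halts with an optimal solution after at most $C\cdot\bigl(m(n+m)+T_{MF}(n,m)\bigr)$ steps. -/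

import Mathlib

/-! ## Machine model

A real random access machine with structured programs.  The memory consists of two-dimensional
arrays, numbered `0, 1, 2, …`, whose cells hold natural numbers, and of two-dimensional arrays
whose cells hold real numbers.  Array cells are accessed at computed indices.  Numbers can be
added, subtracted and compared; there is no multiplication and no conversion between natural
and real numbers. -/

namespace RAM

/-- A memory: `μ.nat a i j` is the cell `(i, j)` of the natural-number array `a`, and
`μ.real a i j` is the cell `(i, j)` of the real array `a`. -/
structure Mem where
  nat : ℕ → ℕ → ℕ → ℕ
  real : ℕ → ℕ → ℕ → ℝ

/-- Natural-number expressions (`sub` is truncated subtraction). -/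
inductive NExp where
  | const (c : ℕ)
  | get (a : ℕ) (i j : NExp)
  | add (e₁ e₂ : NExp)
  | sub (e₁ e₂ : NExp)

/-- Real expressions. -/
inductive RExp where
  | const (q : ℚ)
  | get (a : ℕ) (i j : NExp)
  | add (e₁ e₂ : RExp)
  | sub (e₁ e₂ : RExp)

/-- Tests. -/
inductive Test where
  | natLt (e₁ e₂ : NExp)
  | realLt (e₁ e₂ : RExp)
  | neg (b : Test)
  | conj (b₁ b₂ : Test)

/-- Programs. -/
inductive Cmd where
  | nop
  | storeNat (a : ℕ) (i j e : NExp)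
  | storeReal (a : ℕ) (i j : NExp) (e : RExp)
  | seq (c₁ c₂ : Cmd)
  | branch (b : Test) (c₁ c₂ : Cmd)
  | loop (b : Test) (c : Cmd)

def NExp.eval (μ : Mem) : NExp → ℕ
  | .const c => c
  | .get a i j => μ.nat a (i.eval μ) (j.eval μ)
  | .add e₁ e₂ => e₁.eval μ + e₂.eval μ
  | .sub e₁ e₂ => e₁.eval μ - e₂.eval μ

noncomputable def RExp.eval (μ : Mem) : RExp → ℝ
  | .const q => (q : ℝ)
  | .get a i j => μ.real a (i.eval μ) (j.eval μ)
  | .add e₁ e₂ => e₁.eval μ + e₂.eval μ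
  | .sub e₁ e₂ => e₁.eval μ - e₂.eval μ

def Test.Holds (μ : Mem) : Test → Prop
  | .natLt e₁ e₂ => e₁.eval μ < e₂.eval μ
  | .realLt e₁ e₂ => e₁.eval μ < e₂.eval μ
  | .neg b => ¬ b.Holds μ
  | .conj b₁ b₂ => b₁.Holds μ ∧ b₂.Holds μ

def Mem.setNat (μ : Mem) (a i j v : ℕ) : Mem where
  nat a' i' j' := if a' = a ∧ i' = i ∧ j' = j then v else μ.nat a' i' j'
  real := μ.real

noncomputable def Mem.setReal (μ : Mem) (a i j : ℕ) (v : ℝ) : Mem where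
  nat := μ.nat
  real a' i' j' := if a' = a ∧ i' = i ∧ j' = j then v else μ.real a' i' j'

/-- `Exec c μ t μ'`: started on the memory `μ`, the program `c` halts after `t` steps with the
memory `μ'`.  A step is the execution of one assignment or the evaluation of one test.  (The
expressions that occur in a program have a fixed size, so that each step takes a constant number
of elementary operations.) -/
inductive Exec : Cmd → Mem → ℕ → Mem → Prop where
  | nop (μ : Mem) : Exec .nop μ 1 μ
  | storeNat (μ : Mem) (a : ℕ) (i j e : NExp) :
      Exec (.storeNat a i j e) μ 1 (μ.setNat a (i.eval μ) (j.eval μ) (e.eval μ))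
  | storeReal (μ : Mem) (a : ℕ) (i j : NExp) (e : RExp) :
      Exec (.storeReal a i j e) μ 1 (μ.setReal a (i.eval μ) (j.eval μ) (e.eval μ))
  | seq {c₁ c₂ : Cmd} {μ μ₁ μ₂ : Mem} {t₁ t₂ : ℕ}
      (h₁ : Exec c₁ μ t₁ μ₁) (h₂ : Exec c₂ μ₁ t₂ μ₂) :
      Exec (.seq c₁ c₂) μ (t₁ + t₂) μ₂
  | branchTrue {b : Test} {c₁ c₂ : Cmd} {μ μ' : Mem} {t : ℕ}
      (hb : b.Holds μ) (h : Exec c₁ μ t μ') : Exec (.branch b c₁ c₂) μ (1 + t) μ'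
  | branchFalse {b : Test} {c₁ c₂ : Cmd} {μ μ' : Mem} {t : ℕ}
      (hb : ¬ b.Holds μ) (h : Exec c₂ μ t μ') : Exec (.branch b c₁ c₂) μ (1 + t) μ'
  | loopTrue {b : Test} {c : Cmd} {μ μ₁ μ₂ : Mem} {t₁ t₂ : ℕ}
      (hb : b.Holds μ) (h₁ : Exec c μ t₁ μ₁) (h₂ : Exec (.loop b c) μ₁ t₂ μ₂) :
      Exec (.loop b c) μ (1 + t₁ + t₂) μ₂
  | loopFalse {b : Test} {c : Cmd} {μ : Mem}
      (hb : ¬ b.Holds μ) : Exec (.loop b c) μ 1 μ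

end RAM

/-! ## Flow problems and their running times -/

/-- A network with `n` nodes and `m` directed edges (parallel edges are allowed), natural or
infinite capacities, and real profits per unit of flow. -/
structure Network (n m : ℕ) where
  src : Fin m → Fin n
  tgt : Fin m → Fin n
  cap : Fin m → ℕ∞
  profit : Fin m → ℝ

namespace Network

variable {n m : ℕ}

/-- Net outflow of the node `v`. -/
def excess (G : Network n m) (f : Fin m → ℝ) (v : Fin n) : ℝ :=
  (∑ e with G.src e = v, f e) - ∑ e with G.tgt e = v, f e

/-- Nonnegativity and capacity constraints. -/
def Admissible (G : Network n m) (f : Fin m → ℝ) : Prop :=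
  ∀ e, 0 ≤ f e ∧ ∀ c : ℕ, G.cap e = c → f e ≤ c

def IsCirculation (G : Network n m) (f : Fin m → ℝ) : Prop :=
  G.Admissible f ∧ ∀ v, G.excess f v = 0

def IsMaxProfitCirculation (G : Network n m) (f : Fin m → ℝ) : Prop :=
  G.IsCirculation f ∧
    ∀ g, G.IsCirculation g → ∑ e, G.profit e * g e ≤ ∑ e, G.profit e * f e

/-- Flows from the source `s` to the sink `t`. -/
def IsFlow (G : Network n m) (s t : Fin n) (f : Fin m → ℝ) : Prop :=
  G.Admissible f ∧ ∀ v, v ≠ s → v ≠ t → G.excess f v = 0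

def IsMaxFlow (G : Network n m) (s t : Fin n) (f : Fin m → ℝ) : Prop :=
  G.IsFlow s t f ∧ ∀ g, G.IsFlow s t g → G.excess g s ≤ G.excess f s

open Classical in
/-- The memory `μ` stores the network `G`: cells `(0, 0)` and `(0, 1)` of array `0` hold `n` and
`m`; arrays `1` and `2` hold the end nodes of the edges; array `3` flags the edges of infinite
capacity; array `4` holds the finite capacities; real array `0` holds the profits; the arrays
from `6` on (real arrays from `1` on) are zero.  Array `5` is left for further input. -/
structure StoredIn (G : Network n m) (μ : RAM.Mem) : Prop where
  numNodes : μ.nat 0 0 0 = n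
  numEdges : μ.nat 0 0 1 = m
  src : ∀ e : Fin m, μ.nat 1 0 e = G.src e
  tgt : ∀ e : Fin m, μ.nat 2 0 e = G.tgt e
  capFlag : ∀ e : Fin m, μ.nat 3 0 e = if G.cap e = ⊤ then 1 else 0
  cap : ∀ e : Fin m, μ.nat 4 0 e = (G.cap e).toNat
  profit : ∀ e : Fin m, μ.real 0 0 e = G.profit e
  natZero : ∀ a i j, 6 ≤ a → μ.nat a i j = 0
  realZero : ∀ a i j, 1 ≤ a → μ.real a i j = 0

/-- The flow that a program has left in array `6`. -/
def output (m : ℕ) (μ : RAM.Mem) : Fin m → ℝ := fun e => (μ.nat 6 0 e : ℝ)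

end Network

/-- `T n m` bounds the running time of some algorithm which computes an (integral) maximum
`s`-`t`-flow in every network with `n` nodes and `m` edges in which a maximum flow exists.  The
source and the sink are given in array `5`. -/
def IsMaxFlowTime (T : ℕ → ℕ → ℕ) : Prop :=
  (∀ n m, 1 ≤ T n m) ∧
  ∃ Q : RAM.Cmd, ∀ (n m : ℕ) (G : Network n m) (s t : Fin n) (μ : RAM.Mem),
    s ≠ t → G.StoredIn μ → μ.nat 5 0 0 = s → μ.nat 5 0 1 = t →
    (∃ f, G.IsMaxFlow s t f) →
    ∃ (k : ℕ) (μ' : RAM.Mem), RAM.Exec Q μ k μ' ∧ k ≤ T n m ∧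
      G.IsMaxFlow s t (Network.output m μ')

/-- `T n m` bounds the running time of some algorithm which computes an (integral)
maximum-profit circulation in every network with `n` nodes and `m` edges in which a
maximum-profit circulation exists. -/
def IsMaxProfitCirculationTime (T : ℕ → ℕ → ℕ) : Prop :=
  (∀ n m, 1 ≤ T n m) ∧
  ∃ Q : RAM.Cmd, ∀ (n m : ℕ) (G : Network n m) (μ : RAM.Mem),
    G.StoredIn μ → (∀ i j, μ.nat 5 i j = 0) →
    (∃ f, G.IsMaxProfitCirculation f) →
    ∃ (k : ℕ) (μ' : RAM.Mem), RAM.Exec Q μ k μ' ∧ k ≤ T n m ∧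
      G.IsMaxProfitCirculation (Network.output m μ')

/-! ## The Reward-Penalty-Selection Problem -/

/-- An instance with the player set `Fin N`, `h` reward sets and `l` penalty sets. -/
structure RPSP (N h l : ℕ) where
  rewardSet : Fin h → Finset (Fin N)
  penaltySet : Fin l → Finset (Fin N)
  reward : Fin h → ℝ
  penalty : Fin l → ℝ
  reward_nonneg : ∀ i, 0 ≤ reward i
  penalty_nonneg : ∀ j, 0 ≤ penalty j

namespace RPSP

variable {N h l : ℕ}

/-- The profit of a selection `X`: the rewards of the reward sets that are hit minus the penalties
of the penalty sets that are covered. -/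
def profit (I : RPSP N h l) (X : Finset (Fin N)) : ℝ :=
  (∑ i with (I.rewardSet i ∩ X).Nonempty, I.reward i) -
    ∑ j with I.penaltySet j ⊆ X, I.penalty j

def IsOptimal (I : RPSP N h l) (X : Finset (Fin N)) : Prop :=
  ∀ Y : Finset (Fin N), I.profit Y ≤ I.profit X

/-- All reward sets and penalty sets, as one family. -/
def member (I : RPSP N h l) : Fin h ⊕ Fin l → Finset (Fin N) :=
  Sum.elim I.rewardSet I.penaltySet

/-- Laminar instances: the reward sets are pairwise distinct, the penalty sets are pairwise
distinct, and any two of all these sets are disjoint or comparable. -/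
structure IsLaminar (I : RPSP N h l) : Prop where
  reward_distinct : Function.Injective I.rewardSet
  penalty_distinct : Function.Injective I.penaltySet
  laminar : ∀ s t, I.member s ∩ I.member t = ∅ ∨
    I.member s ⊆ I.member t ∨ I.member t ⊆ I.member s

/-- Some set of the instance contains all the others. -/
def HasRoot (I : RPSP N h l) : Prop := ∃ s, ∀ t, I.member t ⊆ I.member s

/-- The set that belongs to a node of the containment graph; `none` is the artificial root, which
belongs to the set of all players. -/
def nodeSet (I : RPSP N h l) : Option (Fin h ⊕ Fin l) → Finset (Fin N)
  | none => Finset.univ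
  | some s => I.member s

open Classical in
/-- The nodes of the containment graph: one for each reward set and each penalty set, and the
artificial root if no set of the instance contains all the others. -/
noncomputable def nodes (I : RPSP N h l) : Finset (Option (Fin h ⊕ Fin l)) :=
  if I.HasRoot then Finset.univ.erase none else Finset.univ

open Classical in
/-- The edges of the containment graph: from `u` to `v` if the set of `v` is contained in the set
of `u`, for different nodes `u` and `v`. -/
noncomputable def edges (I : RPSP N h l) :
    Finset (Option (Fin h ⊕ Fin l) × Option (Fin h ⊕ Fin l)) :=
  (I.nodes ×ˢ I.nodes).filter fun p => p.1 ≠ p.2 ∧ I.nodeSet p.2 ⊆ I.nodeSet p.1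

noncomputable def numNodes (I : RPSP N h l) : ℕ := I.nodes.card

noncomputable def numEdges (I : RPSP N h l) : ℕ := I.edges.card

/-- The first `S.card` entries of `r` list the elements of `S`, in any order. -/
def Lists (r : ℕ → ℕ) (S : Finset (Fin N)) : Prop :=
  ∃ e : Fin S.card ≃ S, ∀ k : Fin S.card, r k = ((e k : Fin N) : ℕ)

/-- The row in which a set is stored: first the reward sets, then the penalty sets. -/
def row : Fin h ⊕ Fin l → ℕ
  | .inl i => i
  | .inr j => h + j

/-- The memory `μ` stores the instance `I`: cells `(0, 0)`, `(0, 1)` and `(0, 2)` of array `0` hold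
`N`, `h` and `l`; each set is given by its cardinality (array `1`), a list of its elements
(array `2`) and its characteristic vector (array `3`); the rewards and penalties are in real
array `0`; the arrays from `4` on (real arrays from `1` on) are zero. -/
structure StoredIn (I : RPSP N h l) (μ : RAM.Mem) : Prop where
  numPlayers : μ.nat 0 0 0 = N
  numRewards : μ.nat 0 0 1 = h
  numPenalties : μ.nat 0 0 2 = l
  card : ∀ s, μ.nat 1 (row s) 0 = (I.member s).card
  list : ∀ s, Lists (μ.nat 2 (row s)) (I.member s)
  table : ∀ s (x : Fin N), μ.nat 3 (row s) x = if x ∈ I.member s then 1 else 0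
  reward : ∀ i, μ.real 0 (row (.inl i : Fin h ⊕ Fin l)) 0 = I.reward i
  penalty : ∀ j, μ.real 0 (row (.inr j : Fin h ⊕ Fin l)) 0 = I.penalty j
  natZero : ∀ a i j, 4 ≤ a → μ.nat a i j = 0
  realZero : ∀ a i j, 1 ≤ a → μ.real a i j = 0

/-- The memory `μ` contains a solution of `I`: array `4` holds the cardinality of an optimal
selection, array `5` lists its elements, and real array `1` holds its profit. -/
def SolvedIn (I : RPSP N h l) (μ : RAM.Mem) : Prop :=
  ∃ X : Finset (Fin N), I.IsOptimal X ∧ μ.nat 4 0 0 = X.card ∧ Lists (μ.nat 5 0) X ∧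
    μ.real 1 0 0 = I.profit X

end RPSP

/-! No flow is computed. A greedy algorithm solves the laminar problem in time quadratic in the
number K = h + l of sets, independently of the number of players.

Colour the selected players `true`. The profit is the total reward minus a cost: a set costs its
weight when all its elements have the colour which is its kind (an unhit reward set, a covered
penalty set). The sets are processed by increasing cardinality, keeping a colouring f that is
optimal for the set D of processed indices. Let s be the next one. If f is not monochromatic of the
right kind on s, it stays optimal, since weights are nonnegative. Otherwise every processed set that
meets s lies inside s, where f is constant. An exchange argument (`Laminar.cost_update_le`) shows
that a colouring giving some x in s the other colour costs at least as much as f changed at x alone.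
So either f itself or f with one cheapest change is optimal (`Laminar.isBest_keep`,
`Laminar.isBest_flip`).

To avoid a dependence on N, only K + 1 elements of s are inspected. The change `delta` at x has a
positive summand only if {x} is a set of the opposite kind; for any other x optimality of f forces
`delta` to be 0. At most K elements are blocked in this way, so by pigeonhole K + 1 listed elements
suffice (`Laminar.exists_price_le`). Witness counts make the test for monochromaticity
constant-time, and since each set changes the colour of at most one player, K records suffice to
list the final selection.

Finally K ≤ n ≤ m + 1, because a top node of the containment graph has an edge to every other node;
the summand `T_MF` ≥ 1 covers m = 0. -/

/-! ## Colourings of laminar families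

A selection is viewed as a colouring of the players (`true` for selected).  A reward set has kind
`false`, a penalty set has kind `true`, and a set costs its weight if all of its elements have the
colour which is its kind. -/

/-- A finite sequence of weighted finite sets of natural numbers, of two kinds. -/
structure SetSystem where
  size : ℕ
  set : ℕ → Finset ℕ
  kind : ℕ → Bool
  weight : ℕ → ℝ

namespace SetSystem

variable (F : SetSystem)

/-- All elements of the set `r` have the colour `F.kind r`. -/
def Mono (f : ℕ → Bool) (r : ℕ) : Prop := ∀ x ∈ F.set r, f x = F.kind r

instance (f : ℕ → Bool) (r : ℕ) : Decidable (F.Mono f r) :=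
  inferInstanceAs (Decidable (∀ x ∈ F.set r, f x = F.kind r))

/-- The cost of a colouring with respect to the sets in `D`. -/
def cost (D : Finset ℕ) (f : ℕ → Bool) : ℝ :=
  ∑ r ∈ D, if F.Mono f r then F.weight r else 0

def IsBest (D : Finset ℕ) (f : ℕ → Bool) : Prop := ∀ g, F.cost D f ≤ F.cost D g

/-- The change of the cost when the colour of `x` is changed from `c` to `!c` in a monochromatic
set that is at least as large as the sets in `D`. -/
def delta (D : Finset ℕ) (c : Bool) (x : ℕ) : ℝ :=
  ∑ r ∈ D, ((if F.kind r ≠ c ∧ F.set r = {x} then F.weight r else 0) -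
    if F.kind r = c ∧ x ∈ F.set r then F.weight r else 0)

/-- Some set of the kind `!c` is the singleton of `x`. -/
def Blocked (c : Bool) (x : ℕ) : Prop := ∃ u < F.size, F.kind u ≠ c ∧ F.set u = {x}

open Classical in
/-- The part of `delta` that is maintained by the algorithm. -/
noncomputable def price (D : Finset ℕ) (c : Bool) (x : ℕ) : ℝ :=
  if F.Blocked c x then F.delta D c x else 0

/-- The number of elements of the set `r` which prevent it from being monochromatic. -/
def witnesses (f : ℕ → Bool) (r : ℕ) : ℕ := ((F.set r).filter fun x => f x ≠ F.kind r).card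

structure Laminar : Prop where
  weight_nonneg : ∀ r, 0 ≤ F.weight r
  distinct : ∀ r < F.size, ∀ s < F.size, F.kind r = F.kind s → F.set r = F.set s → r = s
  nested : ∀ r < F.size, ∀ s < F.size,
    Disjoint (F.set r) (F.set s) ∨ F.set r ⊆ F.set s ∨ F.set s ⊆ F.set r

/-- `D` can be extended by `s` in an order of increasing cardinality. -/
structure Extends (D : Finset ℕ) (s : ℕ) : Prop where
  lt_size : ∀ r ∈ D, r < F.size
  new_lt_size : s < F.size
  notMem : s ∉ D
  card_le : ∀ r ∈ D, (F.set r).card ≤ (F.set s).card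

/-! ### The exchange argument and the greedy step -/

variable {F} {D : Finset ℕ} {s x : ℕ} {f g : ℕ → Bool}

theorem witnesses_eq_zero {r : ℕ} : F.witnesses f r = 0 ↔ F.Mono f r := by
  simp [witnesses, Mono, Finset.filter_eq_empty_iff]

/-- The cardinality order rules out that a processed set properly contains the new one, so
laminarity leaves only disjointness or inclusion. -/
theorem Laminar.subset (hF : F.Laminar) (hD : F.Extends D s) {r : ℕ} (hr : r ∈ D)
    (hxr : x ∈ F.set r) (hxs : x ∈ F.set s) : F.set r ⊆ F.set s := by
  rcases hF.nested r (hD.lt_size r hr) s hD.new_lt_size with h | h | h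
  · exact absurd hxs (Finset.disjoint_left.1 h hxr)
  · exact h
  · rw [Finset.eq_of_subset_of_card_le h (hD.card_le r hr)]

theorem cost_insert (hs : s ∉ D) :
    F.cost (insert s D) f = (if F.Mono f s then F.weight s else 0) + F.cost D f := by
  rw [cost, Finset.sum_insert hs, cost]

theorem mono_congr {r : ℕ} (h : ∀ y ∈ F.set r, f y = g y) : F.Mono f r ↔ F.Mono g r := by
  unfold Mono
  exact forall₂_congr fun y hy => by rw [h y hy]

theorem mono_update_of_notMem {r : ℕ} {c : Bool} (h : x ∉ F.set r) :
    F.Mono (Function.update f x c) r ↔ F.Mono f r :=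
  mono_congr fun y hy => Function.update_of_ne (by rintro rfl; exact h hy) _ _

/-- The set `r` lies inside the monochromatic set `s`; once `x` is changed, it disagrees with every
other element of `r`, so only a singleton can be monochromatic. -/
theorem Laminar.mono_update_iff (hF : F.Laminar) (hD : F.Extends D s) (hm : F.Mono f s)
    (hx : x ∈ F.set s) {r : ℕ} (hr : r ∈ D) (hxr : x ∈ F.set r) :
    F.Mono (Function.update f x (!F.kind s)) r ↔ F.kind r ≠ F.kind s ∧ F.set r = {x} := by
  have hsub := hF.subset hD hr hxr hx
  constructor
  · intro h
    have h1 := h x hxr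
    rw [Function.update_self] at h1
    refine ⟨by rw [← h1]; simp, Finset.eq_singleton_iff_unique_mem.2 ⟨hxr, fun y hy => ?_⟩⟩
    by_contra hne
    have h2 := h y hy
    rw [Function.update_of_ne hne, hm y (hsub hy), ← h1] at h2
    simp at h2
  · rintro ⟨h1, h2⟩ y hy
    rw [h2, Finset.mem_singleton] at hy
    subst hy
    rw [Function.update_self]
    revert h1
    cases F.kind r <;> cases F.kind s <;> simp

theorem Laminar.mono_iff (hF : F.Laminar) (hD : F.Extends D s) (hm : F.Mono f s)
    (hx : x ∈ F.set s) {r : ℕ} (hr : r ∈ D) (hxr : x ∈ F.set r) :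
    F.Mono f r ↔ F.kind r = F.kind s := by
  have hsub := hF.subset hD hr hxr hx
  exact ⟨fun h => by rw [← h x hxr, hm x hx], fun h y hy => by rw [h, hm y (hsub hy)]⟩

/-- The increment does not depend on `f` beyond its colour on `s`, so it can be maintained without
tracking the colouring. -/
theorem Laminar.cost_update (hF : F.Laminar) (hD : F.Extends D s) (hm : F.Mono f s)
    (hx : x ∈ F.set s) :
    F.cost D (Function.update f x (!F.kind s)) = F.cost D f + F.delta D (F.kind s) x := by
  rw [cost, cost, delta, ← Finset.sum_add_distrib]
  refine Finset.sum_congr rfl fun r hr => ?_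
  by_cases hxr : x ∈ F.set r
  · simp only [hF.mono_update_iff hD hm hx hr hxr, hF.mono_iff hD hm hx hr hxr, hxr, and_true]
    ring
  · have h1 : F.set r ≠ {x} := fun e => hxr (by rw [e]; exact Finset.mem_singleton_self x)
    simp only [mono_update_of_notMem hxr, hxr, h1, and_false, if_false]
    ring

/-- Exchange the colours of `f` and `g` at `x`: the total cost does not increase, and optimality of
`f` against the altered `g` leaves the claim. Hence changing more than one element never helps. -/
theorem Laminar.cost_update_le (hF : F.Laminar) (hD : F.Extends D s) (hf : F.IsBest D f)
    (hm : F.Mono f s) (hx : x ∈ F.set s) (hg : g x ≠ F.kind s) :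
    F.cost D (Function.update f x (!F.kind s)) ≤ F.cost D g := by
  have key : F.cost D (Function.update f x (!F.kind s)) +
      F.cost D (Function.update g x (F.kind s)) ≤ F.cost D g + F.cost D f := by
    simp only [cost]
    rw [← Finset.sum_add_distrib, ← Finset.sum_add_distrib]
    refine Finset.sum_le_sum fun r hr => ?_
    have hw := hF.weight_nonneg r
    by_cases hxr : x ∈ F.set r
    · rw [if_congr (hF.mono_update_iff hD hm hx hr hxr) rfl rfl,
        if_congr (hF.mono_iff hD hm hx hr hxr) rfl rfl]
      -- For equal kinds, `f` pays for `r` and the change frees it, which covers whatever the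
      -- altered `g` pays. For opposite kinds the altered `g` does not pay, and the altered `f` pays
      -- only for r = {x}, where `g` pays as well.
      by_cases hk : F.kind r = F.kind s
      · simp only [hk, ne_eq, not_true_eq_false, false_and, if_false, if_true]
        split_ifs <;> linarith
      · have h1 : ¬ F.Mono (Function.update g x (F.kind s)) r := fun h => by
          have := h x hxr
          rw [Function.update_self] at this
          exact hk this.symm
        have h2 : F.set r = {x} → F.Mono g r := fun h y hy => by
          rw [h, Finset.mem_singleton] at hy
          subst hy
          revert hk hg
          cases F.kind r <;> cases F.kind s <;> simp
        by_cases h3 : F.set r = {x}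
        · simp [h1, hk, h3, h2 h3]
        · simp only [hk, h1, h3, and_false, if_false]
          split_ifs <;> linarith
    · simp only [mono_update_of_notMem hxr]
      rw [add_comm]
  have := hf (Function.update g x (F.kind s))
  linarith

theorem Laminar.cost_le_insert (hF : F.Laminar) (hD : F.Extends D s) (g : ℕ → Bool) :
    F.cost D g ≤ F.cost (insert s D) g := by
  rw [cost_insert hD.notMem]
  have := hF.weight_nonneg s
  split_ifs <;> linarith

theorem Laminar.isBest_of_not_mono (hF : F.Laminar) (hD : F.Extends D s) (hf : F.IsBest D f)
    (hm : ¬ F.Mono f s) : F.IsBest (insert s D) f := fun g => by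
  rw [cost_insert hD.notMem, if_neg hm, zero_add]
  exact (hf g).trans (hF.cost_le_insert hD g)

theorem exists_of_not_mono (h : ¬ F.Mono f s) : ∃ x ∈ F.set s, f x ≠ F.kind s := by
  simpa [Mono] using h

/-- A competitor either pays for `s`, and then optimality of `f` on `D` suffices, or deviates at
some element of `s`, and then the exchange bound applies. The same dichotomy proves
`Laminar.isBest_flip`. -/
theorem Laminar.isBest_keep (hF : F.Laminar) (hD : F.Extends D s) (hf : F.IsBest D f)
    (hm : F.Mono f s) (hle : ∀ x ∈ F.set s, F.weight s ≤ F.delta D (F.kind s) x) :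
    F.IsBest (insert s D) f := fun g => by
  rw [cost_insert hD.notMem, if_pos hm]
  by_cases hg : F.Mono g s
  · rw [cost_insert hD.notMem, if_pos hg]
    have := hf g
    linarith
  · obtain ⟨x, hx, hgx⟩ := exists_of_not_mono hg
    have h1 := hF.cost_update_le hD hf hm hx hgx
    rw [hF.cost_update hD hm hx] at h1
    have := hle x hx
    have := hF.cost_le_insert hD g
    linarith

theorem Laminar.isBest_flip (hF : F.Laminar) (hD : F.Extends D s) (hf : F.IsBest D f)
    (hm : F.Mono f s) (hx : x ∈ F.set s) (hlt : F.delta D (F.kind s) x ≤ F.weight s)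
    (hle : ∀ y ∈ F.set s, F.delta D (F.kind s) x ≤ F.delta D (F.kind s) y) :
    F.IsBest (insert s D) (Function.update f x (!F.kind s)) := fun g => by
  have hn : ¬ F.Mono (Function.update f x (!F.kind s)) s := fun h => by
    have := h x hx
    rw [Function.update_self] at this
    simp at this
  rw [cost_insert hD.notMem, if_neg hn, zero_add, hF.cost_update hD hm hx]
  by_cases hg : F.Mono g s
  · rw [cost_insert hD.notMem, if_pos hg]
    have := hf g
    linarith
  · obtain ⟨y, hy, hgy⟩ := exists_of_not_mono hg
    have h1 := hF.cost_update_le hD hf hm hy hgy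
    rw [hF.cost_update hD hm hy] at h1
    have := hle y hy
    have := hF.cost_le_insert hD g
    linarith

/-! ### Prices, and why few elements need to be inspected -/

theorem Laminar.delta_nonneg (hF : F.Laminar) (hD : F.Extends D s) (hf : F.IsBest D f)
    (hm : F.Mono f s) (hx : x ∈ F.set s) : 0 ≤ F.delta D (F.kind s) x := by
  have h1 := hF.cost_update hD hm hx
  have h2 := hf (Function.update f x (!F.kind s))
  linarith

/-- Without an opposing singleton every summand of `delta` is nonpositive, while optimality of `f`
makes the sum nonnegative; so storing 0 is exact. -/
theorem Laminar.price_eq_delta (hF : F.Laminar) (hD : F.Extends D s) (hf : F.IsBest D f)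
    (hm : F.Mono f s) (hx : x ∈ F.set s) :
    F.price D (F.kind s) x = F.delta D (F.kind s) x := by
  unfold price
  split_ifs with hb
  · rfl
  · refine le_antisymm (hF.delta_nonneg hD hf hm hx) (Finset.sum_nonpos fun r hr => ?_)
    rw [if_neg fun h => hb ⟨r, hD.lt_size r hr, h⟩, zero_sub, neg_nonpos]
    split_ifs
    exacts [hF.weight_nonneg r, le_rfl]

/-- Justifies cutting the search off after `F.size + 1` list entries: a short list is read
completely, and a long one shows an element of price 0, the least possible. -/
theorem Laminar.exists_price_le (hF : F.Laminar) (hD : F.Extends D s) (hf : F.IsBest D f)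
    (hm : F.Mono f s) {e : ℕ → ℕ} (hmem : ∀ i < (F.set s).card, e i ∈ F.set s)
    (hinj : Set.InjOn e (Set.Iio (F.set s).card)) (hx : x ∈ F.set s) :
    ∃ i < F.size + 1, i < (F.set s).card ∧ F.price D (F.kind s) (e i) ≤ F.price D (F.kind s) x := by
  by_cases hc : (F.set s).card ≤ F.size
  · have himg : (Finset.range (F.set s).card).image e = F.set s := by
      refine Finset.eq_of_subset_of_card_le (fun y hy => ?_) ?_
      · obtain ⟨i, hi, rfl⟩ := Finset.mem_image.1 hy
        exact hmem i (Finset.mem_range.1 hi)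
      · rw [Finset.card_image_of_injOn (by simpa using hinj), Finset.card_range]
    rw [← himg] at hx
    obtain ⟨i, hi, rfl⟩ := Finset.mem_image.1 hx
    have hi := Finset.mem_range.1 hi
    exact ⟨i, by omega, hi, le_rfl⟩
  -- Distinct blocked elements need distinct singleton sets, of which there are at most `F.size`.
  · have hfree : ∃ i < F.size + 1, ¬ F.Blocked (F.kind s) (e i) := by
      by_contra! hcon
      choose! u hu hk hset using hcon
      have := Finset.exists_ne_map_eq_of_card_lt_of_maps_to
        (s := Finset.range (F.size + 1)) (t := Finset.range F.size) (by simp)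
        (f := u) (fun i hi => by simpa using hu i (by simpa using hi))
      obtain ⟨i, hi, j, hj, hij, huij⟩ := this
      simp only [Finset.mem_range] at hi hj
      have h1 : ({e i} : Finset ℕ) = {e j} := by rw [← hset i hi, ← hset j hj, huij]
      exact hij (hinj (Set.mem_Iio.2 (by omega)) (Set.mem_Iio.2 (by omega))
        (Finset.singleton_injective h1))
    obtain ⟨i, hi, hb⟩ := hfree
    refine ⟨i, hi, by omega, ?_⟩
    rw [hF.price_eq_delta hD hf hm hx, price, if_neg hb]
    exact hF.delta_nonneg hD hf hm hx

/-! ### Updating prices and witness counts -/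

theorem delta_insert (hs : s ∉ D) (c : Bool) (x : ℕ) :
    F.delta (insert s D) c x =
      F.delta D c x + ((if F.kind s ≠ c ∧ F.set s = {x} then F.weight s else 0) -
        if F.kind s = c ∧ x ∈ F.set s then F.weight s else 0) := by
  rw [delta, Finset.sum_insert hs, add_comm, delta]

-- `Blocked` refers to the whole system rather than to `D`, so the case distinction in `price` is
-- stable and the new set contributes only its own summand.
open Classical in
theorem price_insert (hD : F.Extends D s) (c : Bool) (x : ℕ) :
    F.price (insert s D) c x =
      F.price D c x + ((if F.kind s ≠ c ∧ F.set s = {x} then F.weight s else 0) -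
        if F.kind s = c ∧ x ∈ F.set s ∧ F.Blocked c x then F.weight s else 0) := by
  unfold price
  by_cases hb : F.Blocked c x
  · simp only [hb, if_true, and_true, delta_insert hD.notMem]
  · have h : ¬ (F.kind s ≠ c ∧ F.set s = {x}) := fun h => hb ⟨s, hD.new_lt_size, h⟩
    simp only [hb, and_false, if_false]
    rw [if_neg h]
    simp

/-- The element `x` is a witness against exactly those sets containing it whose kind is not its
colour. The subtraction is never truncated, as `x` itself was counted before. -/
theorem witnesses_update {c : Bool} {r : ℕ} (hx : f x = c) :
    F.witnesses (Function.update f x (!c)) r =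
      if x ∈ F.set r then (if F.kind r = c then F.witnesses f r + 1 else F.witnesses f r - 1)
      else F.witnesses f r := by
  unfold witnesses
  by_cases hxr : x ∈ F.set r
  · rw [if_pos hxr]
    by_cases hk : F.kind r = c
    · rw [if_pos hk]
      have : (F.set r).filter (fun y => Function.update f x (!c) y ≠ F.kind r) =
          insert x ((F.set r).filter fun y => f y ≠ F.kind r) := by
        ext y
        by_cases hy : y = x
        · subst hy; simp [hxr, hk]
        · simp [hy]
      rw [this, Finset.card_insert_of_notMem]
      simp [hx, hk]
    · rw [if_neg hk]
      have hk' : (!c) = F.kind r := by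
        revert hk; cases F.kind r <;> cases c <;> simp
      have : (F.set r).filter (fun y => Function.update f x (!c) y ≠ F.kind r) =
          ((F.set r).filter fun y => f y ≠ F.kind r).erase x := by
        ext y
        by_cases hy : y = x
        · subst hy; simp [hk']
        · simp [hy]
      rw [this, Finset.card_erase_of_mem]
      simp only [Finset.mem_filter, hxr, hx, true_and]
      exact fun h => hk h.symm
  · rw [if_neg hxr]
    congr 1
    refine Finset.filter_congr fun y hy => ?_
    rw [Function.update_of_ne (by rintro rfl; exact hxr hy)]

end SetSystem

/-! ## A program calculus -/

namespace RAM

/-- Started on `μ`, the program `c` halts after at most `t` steps with a memory that satisfies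
`Q`. -/
def Runs (c : Cmd) (μ : Mem) (t : ℕ) (Q : Mem → Prop) : Prop :=
  ∃ k μ', Exec c μ k μ' ∧ k ≤ t ∧ Q μ'

variable {c c₁ c₂ : Cmd} {μ ν : Mem} {t t₁ t₂ : ℕ} {P Q : Mem → Prop} {b : Test}

theorem Runs.mono (h : Runs c μ t₁ P) (ht : t₁ ≤ t₂) (hPQ : ∀ μ', P μ' → Q μ') :
    Runs c μ t₂ Q :=
  let ⟨k, μ', he, hk, hP⟩ := h
  ⟨k, μ', he, hk.trans ht, hPQ μ' hP⟩

theorem Runs.nop (h : Q μ) : Runs .nop μ (t + 1) Q := ⟨1, μ, .nop μ, by omega, h⟩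

theorem Runs.storeNat {a : ℕ} {i j e : NExp} (h : Q (μ.setNat a (i.eval μ) (j.eval μ) (e.eval μ))) :
    Runs (.storeNat a i j e) μ (t + 1) Q := ⟨1, _, .storeNat μ a i j e, by omega, h⟩

theorem Runs.storeReal {a : ℕ} {i j : NExp} {e : RExp}
    (h : Q (μ.setReal a (i.eval μ) (j.eval μ) (e.eval μ))) :
    Runs (.storeReal a i j e) μ (t + 1) Q := ⟨1, _, .storeReal μ a i j e, by omega, h⟩

theorem Runs.seq (h : Runs c₁ μ t₁ fun μ₁ => Runs c₂ μ₁ t₂ Q) :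
    Runs (.seq c₁ c₂) μ (t₁ + t₂) Q := by
  obtain ⟨k₁, μ₁, h₁, hk₁, k₂, μ₂, h₂, hk₂, hQ⟩ := h
  exact ⟨_, _, .seq h₁ h₂, by omega, hQ⟩

theorem Runs.branch (h₁ : b.Holds μ → Runs c₁ μ t Q) (h₂ : ¬ b.Holds μ → Runs c₂ μ t Q) :
    Runs (.branch b c₁ c₂) μ (1 + t) Q := by
  by_cases hb : b.Holds μ
  · obtain ⟨k, μ', h, hk, hQ⟩ := h₁ hb
    exact ⟨_, _, .branchTrue hb h, by omega, hQ⟩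
  · obtain ⟨k, μ', h, hk, hQ⟩ := h₂ hb
    exact ⟨_, _, .branchFalse hb h, by omega, hQ⟩

/-- The content of a scalar variable. -/
abbrev var (a : ℕ) : NExp := .get a (.const 0) (.const 0)

/-- The entry `e` of a one-dimensional array. -/
abbrev entry (a : ℕ) (e : NExp) : NExp := .get a e (.const 0)

/-- Execute `c` with the values `0, 1, …, bound - 1` of the variable `v`. -/
def forLoop (v : ℕ) (bound : NExp) (c : Cmd) : Cmd :=
  .seq (.storeNat v (.const 0) (.const 0) (.const 0))
    (.loop (.natLt (var v) bound)
      (.seq c (.storeNat v (.const 0) (.const 0) (.add (var v) (.const 1)))))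

/-- Each round adds one test and one increment to the body; the initialisation and the failing test
give the final 2. The invariant must ignore the counter (`hv`), since the increment follows the
body. -/
theorem Runs.forLoop {v : ℕ} {bound : NExp} {n : ℕ} {Inv : ℕ → Mem → Prop}
    (hv : ∀ i μ x, Inv i μ → Inv i (μ.setNat v 0 0 x))
    (hn : ∀ i μ, Inv i μ → bound.eval μ = n)
    (h₀ : Inv 0 μ)
    (hstep : ∀ i < n, ∀ μ, Inv i μ → μ.nat v 0 0 = i →
      Runs c μ t fun μ' => μ'.nat v 0 0 = i ∧ Inv (i + 1) μ')
    (hend : ∀ μ, Inv n μ → Q μ) :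
    Runs (RAM.forLoop v bound c) μ (n * (t + 2) + 2) Q := by
  have key : ∀ d i μ, i + d = n → Inv i μ → μ.nat v 0 0 = i →
      Runs (.loop (.natLt (var v) bound)
        (.seq c (.storeNat v (.const 0) (.const 0) (.add (var v) (.const 1)))))
        μ (d * (t + 2) + 1) Q := by
    intro d
    induction d with
    | zero =>
      intro i μ hi hI hc
      refine ⟨1, μ, .loopFalse ?_, by omega, hend μ ?_⟩
      · simp only [Test.Holds, NExp.eval, hc, hn i μ hI]
        omega
      · rwa [← hi]
    | succ d ih =>
      intro i μ hi hI hc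
      obtain ⟨k, μ₁, he, hk, hc₁, hI₁⟩ := hstep i (by omega) μ hI hc
      have hs := Exec.storeNat μ₁ v (.const 0) (.const 0) (.add (var v) (.const 1))
      simp only [NExp.eval, hc₁] at hs
      obtain ⟨k', μ₂, he', hk', hQ⟩ := ih (i + 1) (μ₁.setNat v 0 0 (i + 1)) (by omega)
        (hv _ _ _ hI₁) (by simp [Mem.setNat])
      refine ⟨_, _, .loopTrue ?_ (.seq he hs) he', ?_, hQ⟩
      · simp only [Test.Holds, NExp.eval, hc, hn i μ hI]
        omega
      · rw [Nat.succ_mul]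
        omega
  have h := key n 0 (μ.setNat v 0 0 0) (by omega) (hv _ _ _ h₀) (by simp [Mem.setNat])
  refine (Runs.seq (t₁ := 1) (t₂ := n * (t + 2) + 1) (Runs.storeNat ?_)).mono (by omega) fun _ h => h
  simpa only [NExp.eval] using h

/-- At most the natural-number arrays in `A` and the real arrays in `B` have changed. -/
structure Frame (A B : List ℕ) (μ ν : Mem) : Prop where
  nat : ∀ a ∉ A, ν.nat a = μ.nat a
  real : ∀ a ∉ B, ν.real a = μ.real a

@[simp] theorem setNat_nat_of_ne {a a' : ℕ} (h : a' ≠ a) (i j v : ℕ) :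
    (μ.setNat a i j v).nat a' = μ.nat a' := by
  funext i' j'
  simp [Mem.setNat, h]

@[simp] theorem setNat_nat_self (a i j v i' j' : ℕ) :
    (μ.setNat a i j v).nat a i' j' = if i' = i ∧ j' = j then v else μ.nat a i' j' := by
  simp [Mem.setNat]

@[simp] theorem setNat_real (a i j v : ℕ) : (μ.setNat a i j v).real = μ.real := rfl

@[simp] theorem setReal_nat (a i j : ℕ) (v : ℝ) : (μ.setReal a i j v).nat = μ.nat := rfl

@[simp] theorem setReal_real_of_ne {a a' : ℕ} (h : a' ≠ a) (i j : ℕ) (v : ℝ) :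
    (μ.setReal a i j v).real a' = μ.real a' := by
  funext i' j'
  simp [Mem.setReal, h]

@[simp] theorem setReal_real_self (a i j : ℕ) (v : ℝ) (i' j' : ℕ) :
    (μ.setReal a i j v).real a i' j' = if i' = i ∧ j' = j then v else μ.real a i' j' := by
  simp [Mem.setReal]

namespace Frame

variable {A B A' B' : List ℕ} {ξ : Mem}

theorem refl (A B : List ℕ) (μ : Mem) : Frame A B μ μ := ⟨fun _ _ => rfl, fun _ _ => rfl⟩

theorem trans (h₁ : Frame A B μ ν) (h₂ : Frame A B ν ξ) : Frame A B μ ξ :=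
  ⟨fun a ha => (h₂.nat a ha).trans (h₁.nat a ha), fun a ha => (h₂.real a ha).trans (h₁.real a ha)⟩

theorem weaken (h : Frame A B μ ν) (hA : A ⊆ A') (hB : B ⊆ B') : Frame A' B' μ ν :=
  ⟨fun a ha => h.nat a fun h' => ha (hA h'), fun a ha => h.real a fun h' => ha (hB h')⟩

theorem setNat (h : Frame A B μ ν) {a : ℕ} (ha : a ∈ A) (i j v : ℕ) :
    Frame A B μ (ν.setNat a i j v) :=
  ⟨fun a' ha' => by
    rw [setNat_nat_of_ne (by rintro rfl; exact ha' ha)]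
    exact h.nat a' ha', h.real⟩

theorem setReal (h : Frame A B μ ν) {a : ℕ} (ha : a ∈ B) (i j : ℕ) (v : ℝ) :
    Frame A B μ (ν.setReal a i j v) :=
  ⟨h.nat, fun a' ha' => by
    rw [setReal_real_of_ne (by rintro rfl; exact ha' ha)]
    exact h.real a' ha'⟩

end Frame

end RAM

/-! ## The program -/

namespace RAM

def natEq (e₁ e₂ : NExp) : Test := .conj (.neg (.natLt e₁ e₂)) (.neg (.natLt e₂ e₁))

theorem natEq_holds {e₁ e₂ : NExp} {μ : Mem} : (natEq e₁ e₂).Holds μ ↔ e₁.eval μ = e₂.eval μ := by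
  simp only [natEq, Test.Holds]
  omega

end RAM

namespace SetSystem

open RAM

/-- The input arrays store the set system, whose first `h` sets have the kind `false`. -/
structure Stored (F : SetSystem) (N h : ℕ) (μ : Mem) : Prop where
  numPlayers : μ.nat 0 0 0 = N
  numRewards : μ.nat 0 0 1 = h
  numSets : h + μ.nat 0 0 2 = F.size
  card : ∀ r < F.size, μ.nat 1 r 0 = (F.set r).card
  list_mem : ∀ r < F.size, ∀ i < (F.set r).card, μ.nat 2 r i ∈ F.set r
  list_inj : ∀ r < F.size, Set.InjOn (μ.nat 2 r) (Set.Iio (F.set r).card)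
  table : ∀ r < F.size, ∀ x < N, μ.nat 3 r x = if x ∈ F.set r then 1 else 0
  weight : ∀ r < F.size, μ.real 0 r 0 = F.weight r
  kind : ∀ r < F.size, F.kind r = decide (h ≤ r)
  lt : ∀ r < F.size, ∀ x ∈ F.set r, x < N

/-- Moreover, array `10` contains the kinds and array `11` the number of sets. -/
structure Ready (F : SetSystem) (N h : ℕ) (μ : Mem) : Prop extends F.Stored N h μ where
  kinds : ∀ r < F.size, μ.nat 10 r 0 = (F.kind r).toNat
  size : μ.nat 11 0 0 = F.size

/-- Array `7` contains the colouring `f`, array `8` the numbers of witnesses, and array `9`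
records all selected players, increased by one. -/
structure Coloured (F : SetSystem) (N : ℕ) (f : ℕ → Bool) (μ : Mem) : Prop where
  color : ∀ x < N, μ.nat 7 x 0 = (f x).toNat
  wit : ∀ r < F.size, μ.nat 8 r 0 = F.witnesses f r
  recorded : ∀ x, f x = true → ∃ s < F.size, μ.nat 9 s 0 = x + 1
  record_mem : ∀ s < F.size, ∀ x, μ.nat 9 s 0 = x + 1 → x ∈ F.set s

/-- Array `6` flags the sets in `D`, and real array `2` contains the prices. -/
structure Progress (F : SetSystem) (D : Finset ℕ) (μ : Mem) : Prop where
  done : ∀ r < F.size, μ.nat 6 r 0 = if r ∈ D then 1 else 0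
  price : ∀ c x, μ.real 2 c.toNat x = F.price D c x

/-- The sets in `D` come first in an order of increasing cardinality. -/
structure Initial (F : SetSystem) (D : Finset ℕ) : Prop where
  lt_size : ∀ r ∈ D, r < F.size
  card_le : ∀ r ∈ D, ∀ s < F.size, s ∉ D → (F.set r).card ≤ (F.set s).card

variable {F : SetSystem} {N h : ℕ} {μ ν : Mem} {D : Finset ℕ} {f : ℕ → Bool} {s : ℕ}

theorem Stored.frame {A B : List ℕ} (hμ : F.Stored N h μ) (hf : Frame A B μ ν)
    (hA : ∀ a ∈ A, 4 ≤ a) (hB : ∀ b ∈ B, 1 ≤ b) : F.Stored N h ν := by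
  have hn : ∀ a < 4, ν.nat a = μ.nat a := fun a ha => hf.nat a fun h => by
    have := hA a h
    omega
  have hr : ν.real 0 = μ.real 0 := hf.real 0 fun h => by
    have := hB 0 h
    omega
  constructor
  · rw [hn 0 (by omega)]; exact hμ.numPlayers
  · rw [hn 0 (by omega)]; exact hμ.numRewards
  · rw [hn 0 (by omega)]; exact hμ.numSets
  · rw [hn 1 (by omega)]; exact hμ.card
  · rw [hn 2 (by omega)]; exact hμ.list_mem
  · rw [hn 2 (by omega)]; exact hμ.list_inj
  · rw [hn 3 (by omega)]; exact hμ.table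
  · rw [hr]; exact hμ.weight
  · exact hμ.kind
  · exact hμ.lt

theorem Ready.frame {A B : List ℕ} (hμ : F.Ready N h μ) (hf : Frame A B μ ν)
    (hA : ∀ a ∈ A, 4 ≤ a ∧ a ≠ 10 ∧ a ≠ 11) (hB : ∀ b ∈ B, 1 ≤ b) : F.Ready N h ν := by
  refine ⟨hμ.toStored.frame hf (fun a ha => (hA a ha).1) hB, ?_, ?_⟩
  · rw [hf.nat 10 fun h => by have := hA 10 h; omega]
    exact hμ.kinds
  · rw [hf.nat 11 fun h => by have := hA 11 h; omega]
    exact hμ.size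

theorem Coloured.frame {A B : List ℕ} (hμ : F.Coloured N f μ) (hf : Frame A B μ ν)
    (hA : ∀ a ∈ A, a ≠ 7 ∧ a ≠ 8 ∧ a ≠ 9) : F.Coloured N f ν := by
  have h7 := hf.nat 7 fun h => by have := hA 7 h; omega
  have h8 := hf.nat 8 fun h => by have := hA 8 h; omega
  have h9 := hf.nat 9 fun h => by have := hA 9 h; omega
  constructor
  · rw [h7]; exact hμ.color
  · rw [h8]; exact hμ.wit
  · rw [h9]; exact hμ.recorded
  · rw [h9]; exact hμ.record_mem

theorem Progress.frame {A B : List ℕ} (hμ : F.Progress D μ) (hf : Frame A B μ ν)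
    (hA : 6 ∉ A) (hB : 2 ∉ B) : F.Progress D ν := by
  constructor
  · rw [hf.nat 6 hA]; exact hμ.done
  · rw [hf.real 2 hB]; exact hμ.price

/-! ### The phases of the algorithm and their correctness -/

/-- Compute the number of sets, the kinds and the initial numbers of witnesses. -/
def setup : Cmd :=
  .seq (.storeNat 11 (.const 0) (.const 0)
      (.add (.get 0 (.const 0) (.const 1)) (.get 0 (.const 0) (.const 2))))
    (forLoop 13 (var 11)
      (.branch (.natLt (var 13) (.get 0 (.const 0) (.const 1))) .nop
        (.seq (.storeNat 10 (var 13) (.const 0) (.const 1))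
          (.storeNat 8 (var 13) (.const 0) (entry 1 (var 13))))))

/-- In the constant colouring `false` a reward set has no witness, and every element of a penalty
set is one. -/
theorem setup_runs (hμ : F.Stored N h μ) (h8 : ∀ r, μ.nat 8 r 0 = 0)
    (h10 : ∀ r, μ.nat 10 r 0 = 0) :
    Runs setup μ (F.size * 5 + 3) fun ν => Frame [8, 10, 11, 13] [] μ ν ∧ F.Ready N h ν ∧
      ∀ r < F.size, ν.nat 8 r 0 = F.witnesses (fun _ => false) r := by
  have hfr : Frame [8, 10, 11, 13] [] μ (μ.setNat 11 0 0 F.size) :=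
    (Frame.refl _ _ _).setNat (by simp) _ _ _
  refine (Runs.seq (t₁ := 1) (t₂ := F.size * (3 + 2) + 2) (Runs.storeNat ?_)).mono (by omega)
    fun _ h => h
  have hK : μ.nat 0 0 1 + μ.nat 0 0 2 = F.size := by rw [hμ.numRewards]; exact hμ.numSets
  simp only [NExp.eval, hK]
  refine Runs.forLoop (Inv := fun i ν => Frame [8, 10, 11, 13] [] μ ν ∧ ν.nat 11 0 0 = F.size ∧
    (∀ r, ν.nat 8 r 0 = if h ≤ r ∧ r < i then (F.set r).card else 0) ∧
    ∀ r, ν.nat 10 r 0 = if h ≤ r ∧ r < i then 1 else 0) ?_ ?_ ?_ ?_ ?_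
  · rintro i ν x ⟨hf, hb, hc, hd⟩
    exact ⟨hf.setNat (by simp) _ _ _, by simpa using hb, by simpa using hc, by simpa using hd⟩
  · rintro i ν ⟨_, hb, _⟩
    exact hb
  · exact ⟨hfr, by simp, by simpa using h8, by simpa using h10⟩
  · rintro i hi ν ⟨hf, hb, hc, hd⟩ hvi
    have hS := hμ.frame hf (by simp) (by simp)
    refine Runs.branch (t := 2) (fun hlt => Runs.nop ?_) fun hlt => ?_
    · simp only [Test.Holds, NExp.eval, hvi, hS.numRewards] at hlt
      refine ⟨hvi, hf, hb, fun r => ?_, fun r => ?_⟩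
      · rw [hc]
        exact if_congr (by omega) rfl rfl
      · rw [hd]
        exact if_congr (by omega) rfl rfl
    · simp only [Test.Holds, NExp.eval, hvi, hS.numRewards] at hlt
      refine Runs.seq (t₁ := 1) (t₂ := 1) (Runs.storeNat (Runs.storeNat ?_))
      simp only [NExp.eval, hvi, setNat_nat_of_ne, ne_eq,
        Nat.reduceEqDiff, not_false_eq_true, OfNat.one_ne_ofNat]
      refine ⟨by simp, (hf.setNat (by simp) _ _ _).setNat (by simp) _ _ _, by simp [hb],
        fun r => ?_, fun r => ?_⟩
      · simp only [setNat_nat_self, and_true]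
        rcases eq_or_ne r i with rfl | hne
        · rw [if_pos rfl, if_pos (by omega), hS.card r hi]
        · rw [if_neg hne, setNat_nat_of_ne (by decide), hc]
          exact if_congr (by omega) rfl rfl
      · simp only [setNat_nat_self, and_true]
        rcases eq_or_ne r i with rfl | hne
        · rw [if_pos rfl, if_pos (by omega)]
        · rw [if_neg hne, hd]
          exact if_congr (by omega) rfl rfl
  · rintro ν ⟨hf, hb, hc, hd⟩
    have hS := hμ.frame hf (by simp) (by simp)
    refine ⟨hf, ⟨hS, fun r hr => ?_, hb⟩, fun r hr => ?_⟩
    · rw [hd, hS.kind r hr]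
      by_cases hhr : h ≤ r <;> simp [hhr, hr]
    · rw [hc, witnesses, hS.kind r hr]
      by_cases hhr : h ≤ r <;> simp [hhr, hr]

/-- Store an unfinished set of minimal cardinality in variable `14`. -/
def select : Cmd :=
  .seq (.storeNat 15 (.const 0) (.const 0) (.add (.get 0 (.const 0) (.const 0)) (.const 1)))
    (forLoop 13 (var 11)
      (.branch (.conj (.natLt (entry 6 (var 13)) (.const 1)) (.natLt (entry 1 (var 13)) (var 15)))
        (.seq (.storeNat 14 (.const 0) (.const 0) (var 13))
          (.storeNat 15 (.const 0) (.const 0) (entry 1 (var 13))))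
        .nop))

theorem select_runs (hμ : F.Ready N h μ) (hp : F.Progress D μ) (hD : F.Initial D)
    (hne : ∃ r < F.size, r ∉ D) :
    Runs select μ (F.size * 5 + 3) fun ν => Frame [13, 14, 15] [] μ ν ∧
      F.Extends D (ν.nat 14 0 0) ∧
      ∀ r < F.size, r ∉ D → (F.set (ν.nat 14 0 0)).card ≤ (F.set r).card := by
  have hN : ∀ r < F.size, (F.set r).card ≤ N := fun r hr => by
    simpa using Finset.card_le_card (t := Finset.range N)
      fun x hx => Finset.mem_range.2 (hμ.lt r hr x hx)
  refine (Runs.seq (t₁ := 1) (t₂ := F.size * (3 + 2) + 2) (Runs.storeNat ?_)).mono (by omega)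
    fun _ h => h
  simp only [NExp.eval, hμ.numPlayers]
  -- Variable 15 starts at N + 1, above every cardinality, so a value at most N certifies that a set
  -- has been found.
  refine Runs.forLoop (Inv := fun i ν => Frame [13, 14, 15] [] μ ν ∧
    (∀ j < i, j < F.size → j ∉ D → ν.nat 15 0 0 ≤ (F.set j).card) ∧
    (ν.nat 15 0 0 ≤ N → ν.nat 14 0 0 < F.size ∧ ν.nat 14 0 0 ∉ D ∧
      (F.set (ν.nat 14 0 0)).card = ν.nat 15 0 0)) ?_ ?_ ?_ ?_ ?_
  · rintro i ν x ⟨hf, hb, hc⟩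
    exact ⟨hf.setNat (by simp) _ _ _, by simpa using hb, by simpa using hc⟩
  · rintro i ν ⟨hf, _⟩
    exact (hμ.frame hf (by simp) (by simp)).size
  · exact ⟨(Frame.refl _ _ _).setNat (by simp) _ _ _, by simp, by simp⟩
  · rintro i hi ν ⟨hf, hb, hc⟩ hvi
    have hS := hμ.frame hf (by simp) (by simp)
    have hP := hp.frame hf (by simp) (by simp)
    refine Runs.branch (t := 2) (fun hlt => ?_) fun hlt => Runs.nop ?_
    · simp only [Test.Holds, NExp.eval, hvi, hS.card i hi, hP.done i hi] at hlt
      obtain ⟨h1, h2⟩ := hlt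
      have h3 : i ∉ D := fun h => by simp [h] at h1
      refine Runs.seq (t₁ := 1) (t₂ := 1) (Runs.storeNat (Runs.storeNat ?_))
      refine ⟨by simpa using hvi, (hf.setNat (by simp) _ _ _).setNat (by simp) _ _ _, ?_, ?_⟩
      · intro j hj hj' hjD
        simp only [NExp.eval, hvi, setNat_nat_self, and_self, if_true, ne_eq, setNat_nat_of_ne,
          Nat.reduceEqDiff, not_false_eq_true, OfNat.one_ne_ofNat,
          hS.card i hi]
        rcases eq_or_ne j i with rfl | hji
        · exact le_rfl
        · exact h2.le.trans (hb j (by omega) hj' hjD)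
      · simp [NExp.eval, hvi, hS.card i hi, hi, h3]
    · simp only [Test.Holds, NExp.eval, hvi, hS.card i hi, hP.done i hi] at hlt
      refine ⟨hvi, hf, fun j hj hj' hjD => ?_, hc⟩
      rcases eq_or_ne j i with rfl | hji
      · simpa [hjD] using hlt
      · exact hb j (by omega) hj' hjD
  · rintro ν ⟨hf, hb, hc⟩
    obtain ⟨r, hr, hrD⟩ := hne
    obtain ⟨h1, h2, h3⟩ := hc ((hb r hr hr hrD).trans (hN r hr))
    exact ⟨hf, ⟨hD.lt_size, h1, h2, fun q hq => hD.card_le q hq _ h1 h2⟩,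
      fun q hq hqD => h3 ▸ hb q hq hq hqD⟩

/-- Search the cheapest element of the set in variable `14`; store it, increased by one, in
variable `16` if its price is less than the weight of the set, and store `0` if there is none. -/
def search : Cmd :=
  .seq (.storeNat 16 (.const 0) (.const 0) (.const 0))
    (.seq (.storeReal 3 (.const 0) (.const 0) (.get 0 (var 14) (.const 0)))
      (forLoop 13 (.add (var 11) (.const 1))
        (.branch (.conj (.natLt (var 13) (entry 1 (var 14)))
            (.realLt (.get 2 (entry 10 (var 14)) (.get 2 (var 14) (var 13)))
              (.get 3 (.const 0) (.const 0))))
          (.seq (.storeReal 3 (.const 0) (.const 0)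
              (.get 2 (entry 10 (var 14)) (.get 2 (var 14) (var 13))))
            (.storeNat 16 (.const 0) (.const 0) (.add (.get 2 (var 14) (var 13)) (.const 1))))
          .nop)))

theorem search_runs (hμ : F.Ready N h μ) (hp : F.Progress D μ) (hs : s < F.size)
    (hsv : μ.nat 14 0 0 = s) :
    Runs search μ (F.size * 5 + 10) fun ν => Frame [13, 16] [3] μ ν ∧
      ((ν.nat 16 0 0 = 0 ∧ ∀ i < F.size + 1, i < (F.set s).card →
          F.weight s ≤ F.price D (F.kind s) (μ.nat 2 s i)) ∨
        ∃ x ∈ F.set s, ν.nat 16 0 0 = x + 1 ∧ F.price D (F.kind s) x < F.weight s ∧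
          ∀ i < F.size + 1, i < (F.set s).card →
            F.price D (F.kind s) x ≤ F.price D (F.kind s) (μ.nat 2 s i)) := by
  refine (Runs.seq (t₁ := 1) (t₂ := 1 + ((F.size + 1) * (3 + 2) + 2)) (Runs.storeNat
    (Runs.seq (t₁ := 1) (t₂ := (F.size + 1) * (3 + 2) + 2) (Runs.storeReal ?_)))).mono (by omega)
    fun _ h => h
  -- Real variable 3 is the running minimum, started at the weight of `s`: keeping the colouring
  -- competes with the changes and wins ties.
  refine Runs.forLoop (Inv := fun i ν => Frame [13, 16] [3] μ ν ∧
    (∀ j < i, j < (F.set s).card → ν.real 3 0 0 ≤ F.price D (F.kind s) (μ.nat 2 s j)) ∧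
    ((ν.nat 16 0 0 = 0 ∧ ν.real 3 0 0 = F.weight s) ∨ ∃ x ∈ F.set s, ν.nat 16 0 0 = x + 1 ∧
      ν.real 3 0 0 = F.price D (F.kind s) x ∧ F.price D (F.kind s) x < F.weight s)) ?_ ?_ ?_ ?_ ?_
  · rintro i ν x ⟨hf, hb, hc⟩
    exact ⟨hf.setNat (by simp) _ _ _, by simpa using hb, by simpa using hc⟩
  · rintro i ν ⟨hf, _⟩
    simp only [NExp.eval, (hμ.frame hf (by simp) (by simp)).size]
  · refine ⟨((Frame.refl _ _ _).setNat (by simp) _ _ _).setReal (by simp) _ _ _, by simp, .inl ?_⟩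
    simp [NExp.eval, RExp.eval, hsv, hμ.weight s hs]
  · rintro i hi ν ⟨hf, hb, hc⟩ hvi
    have hS := hμ.frame hf (by simp) (by simp)
    have hP := hp.frame hf (by simp) (by simp)
    have h14 : ν.nat 14 0 0 = s := by rw [hf.nat 14 (by simp), hsv]
    have h2 : ν.nat 2 = μ.nat 2 := hf.nat 2 (by simp)
    refine Runs.branch (t := 2) (fun hlt => ?_) fun hlt => Runs.nop ?_
    · simp only [Test.Holds, NExp.eval, RExp.eval, hvi, h14, hS.card s hs, hS.kinds s hs,
        hP.price, h2] at hlt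
      obtain ⟨h3, h4⟩ := hlt
      refine Runs.seq (t₁ := 1) (t₂ := 1) (Runs.storeReal (Runs.storeNat ?_))
      refine ⟨by simpa using hvi, (hf.setReal (by simp) _ _ _).setNat (by simp) _ _ _, ?_, ?_⟩
      · intro j hj hj'
        simp only [NExp.eval, RExp.eval, hvi, h14, hS.kinds s hs, hP.price, h2, setNat_real,
          setReal_real_self, and_self, if_true]
        rcases eq_or_ne j i with rfl | hji
        · exact le_rfl
        · exact h4.le.trans (hb j (by omega) hj')
      · refine .inr ⟨μ.nat 2 s i, hμ.list_mem s hs i h3, ?_, ?_, ?_⟩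
        · simp [NExp.eval, hvi, h14, h2]
        · simp [NExp.eval, RExp.eval, hvi, h14, hS.kinds s hs, hP.price, h2]
        · rcases hc with ⟨_, hc⟩ | ⟨_, _, _, hc, hc'⟩
          · rwa [hc] at h4
          · rw [hc] at h4
            exact h4.trans hc'
    · simp only [Test.Holds, NExp.eval, RExp.eval, hvi, h14, hS.card s hs, hS.kinds s hs,
        hP.price, h2, not_and, not_lt] at hlt
      refine ⟨hvi, hf, fun j hj hj' => ?_, hc⟩
      rcases eq_or_ne j i with rfl | hji
      · exact hlt hj'
      · exact hb j (by omega) hj'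
  · rintro ν ⟨hf, hb, ⟨h1, h2⟩ | ⟨x, hx, h1, h2, h3⟩⟩
    · exact ⟨hf, .inl ⟨h1, fun i hi hi' => h2 ▸ hb i hi hi'⟩⟩
    · exact ⟨hf, .inr ⟨x, hx, h1, h3, fun i hi hi' => h2 ▸ hb i hi hi'⟩⟩

/-- Change the colour of the element in variable `16`, if there is one. -/
def flip : Cmd :=
  .branch (.natLt (.const 0) (var 16))
    (.seq (.storeNat 9 (var 14) (.const 0) (var 16))
      (.seq (.storeNat 7 (.sub (var 16) (.const 1)) (.const 0)
          (.sub (.const 1) (entry 10 (var 14))))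
        (forLoop 13 (var 11)
          (.branch (.natLt (.const 0) (.get 3 (var 13) (.sub (var 16) (.const 1))))
            (.branch (natEq (entry 10 (var 13)) (entry 10 (var 14)))
              (.storeNat 8 (var 13) (.const 0) (.add (entry 8 (var 13)) (.const 1)))
              (.storeNat 8 (var 13) (.const 0) (.sub (entry 8 (var 13)) (.const 1))))
            .nop))))
    .nop

theorem toNat_not (c : Bool) : (!c).toNat = 1 - c.toNat := by cases c <;> rfl

theorem toNat_inj {c d : Bool} : c.toNat = d.toNat ↔ c = d := by cases c <;> cases d <;> simp

theorem flip_runs (hμ : F.Ready N h μ) (hc : F.Coloured N f μ) (hs : s < F.size)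
    (hsv : μ.nat 14 0 0 = s) {x : ℕ} (hx : x ∈ F.set s) (hfx : f x = F.kind s)
    (hrec : μ.nat 9 s 0 = 0) (hxv : μ.nat 16 0 0 = x + 1) :
    Runs flip μ (F.size * 5 + 5) fun ν => Frame [7, 8, 9, 13] [] μ ν ∧
      F.Coloured N (Function.update f x (!F.kind s)) ν ∧
      ∀ r ≠ s, ν.nat 9 r 0 = μ.nat 9 r 0 := by
  have hxN := hμ.lt s hs x hx
  refine (Runs.branch (t := 1 + (1 + (F.size * (3 + 2) + 2))) (fun _ => ?_) fun hn => ?_).mono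
    (by omega) fun _ h => h
  swap
  · simp only [Test.Holds, NExp.eval, hxv] at hn
    omega
  refine Runs.seq (Runs.storeNat (t := 0) (Runs.seq (Runs.storeNat (t := 0) ?_)))
  have e14 : (μ.setNat 9 s 0 (x + 1)).nat 14 0 0 = s := by simpa using hsv
  have e16 : (μ.setNat 9 s 0 (x + 1)).nat 16 0 0 = x + 1 := by simpa using hxv
  have e10 : (μ.setNat 9 s 0 (x + 1)).nat 10 s 0 = (F.kind s).toNat := by
    simpa using hμ.kinds s hs
  simp only [NExp.eval, hsv, hxv, e14, e16, e10, Nat.add_sub_cancel, ← toNat_not]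
  refine Runs.forLoop (Inv := fun i ν => Frame [7, 8, 9, 13] [] μ ν ∧
    (∀ y, ν.nat 7 y 0 = if y = x then (!F.kind s).toNat else μ.nat 7 y 0) ∧
    (∀ r < F.size, ν.nat 8 r 0 =
      if r < i then F.witnesses (Function.update f x (!F.kind s)) r else F.witnesses f r) ∧
    ∀ r, ν.nat 9 r 0 = if r = s then x + 1 else μ.nat 9 r 0) ?_ ?_ ?_ ?_ ?_
  · rintro i ν y ⟨hf, hb, hd, he⟩
    exact ⟨hf.setNat (by simp) _ _ _, by simpa using hb, by simpa using hd, by simpa using he⟩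
  · rintro i ν ⟨hf, _⟩
    exact (hμ.frame hf (by simp) (by simp)).size
  · exact ⟨((Frame.refl _ _ _).setNat (by simp) _ _ _).setNat (by simp) _ _ _, by simp,
      by simpa using hc.wit, by simp⟩
  · rintro i hi ν ⟨hf, hb, hd, he⟩ hvi
    have hS := hμ.frame hf (by simp) (by simp)
    have h14 : ν.nat 14 0 0 = s := by rw [hf.nat 14 (by simp), hsv]
    have h16 : ν.nat 16 0 0 = x + 1 := by rw [hf.nat 16 (by simp), hxv]
    have hw := witnesses_update (F := F) (r := i) hfx
    have hwi := hd i hi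
    rw [if_neg (lt_irrefl i)] at hwi
    have hset : ∀ v, v = F.witnesses (Function.update f x (!F.kind s)) i →
        (ν.setNat 8 i 0 v).nat 13 0 0 = i ∧ Frame [7, 8, 9, 13] [] μ (ν.setNat 8 i 0 v) ∧
        (∀ y, (ν.setNat 8 i 0 v).nat 7 y 0 =
          if y = x then (!F.kind s).toNat else μ.nat 7 y 0) ∧
        (∀ r < F.size, (ν.setNat 8 i 0 v).nat 8 r 0 =
          if r < i + 1 then F.witnesses (Function.update f x (!F.kind s)) r
            else F.witnesses f r) ∧
        ∀ r, (ν.setNat 8 i 0 v).nat 9 r 0 = if r = s then x + 1 else μ.nat 9 r 0 := by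
      rintro v rfl
      refine ⟨by simpa using hvi, hf.setNat (by simp) _ _ _, by simpa using hb,
        fun r hr => ?_, by simpa using he⟩
      rw [setNat_nat_self]
      rcases eq_or_ne r i with rfl | hri
      · simp
      · rw [if_neg (by simp [hri]), hd r hr]
        exact if_congr (by omega) rfl rfl
    refine Runs.branch (t := 2) (fun hlt => ?_) fun hlt => Runs.nop ?_
    · simp only [Test.Holds, NExp.eval, hvi, h16, Nat.add_sub_cancel, hS.table i hi x hxN] at hlt
      have hxi : x ∈ F.set i := by
        by_contra hxi
        simp [hxi] at hlt
      rw [if_pos hxi] at hw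
      refine Runs.branch (t := 1) (fun hk => ?_) fun hk => ?_
      · simp only [natEq_holds, NExp.eval, hvi, h14, hS.kinds i hi, hS.kinds s hs,
          toNat_inj] at hk
        rw [if_pos hk] at hw
        refine Runs.storeNat ?_
        simp only [NExp.eval, hvi]
        exact hset _ (by rw [hwi, hw])
      · simp only [natEq_holds, NExp.eval, hvi, h14, hS.kinds i hi, hS.kinds s hs,
          toNat_inj] at hk
        rw [if_neg hk] at hw
        refine Runs.storeNat ?_
        simp only [NExp.eval, hvi]
        exact hset _ (by rw [hwi, hw])
    · simp only [Test.Holds, NExp.eval, hvi, h16, Nat.add_sub_cancel, hS.table i hi x hxN] at hlt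
      have hxi : x ∉ F.set i := by
        by_contra hxi
        simp [hxi] at hlt
      rw [if_neg hxi] at hw
      refine ⟨hvi, hf, hb, fun r hr => ?_, he⟩
      rcases eq_or_ne r i with rfl | hri
      · rw [if_pos (by omega), hw, hwi]
      · rw [hd r hr]
        exact if_congr (by omega) rfl rfl
  · rintro ν ⟨hf, hb, hd, he⟩
    refine ⟨hf, ⟨fun y hy => ?_, fun r hr => by rw [hd r hr, if_pos hr], fun y hy => ?_,
      fun r hr y hy => ?_⟩, fun r hr => by rw [he, if_neg hr]⟩
    · rw [hb, Function.update_apply]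
      split_ifs
      · rfl
      · exact hc.color y hy
    · rw [Function.update_apply] at hy
      split_ifs at hy with hyx
      · exact ⟨s, hs, by rw [he, if_pos rfl, hyx]⟩
      · obtain ⟨r, hr, hry⟩ := hc.recorded y hy
        refine ⟨r, hr, ?_⟩
        -- Row `s` held 0 before, so the new record overwrites no earlier one.
        rw [he, if_neg, hry]
        rintro rfl
        omega
    · rw [he] at hy
      split_ifs at hy with hrs
      · obtain rfl : x = y := by omega
        exact hrs ▸ hx
      · exact hc.record_mem r hr y hy

/-- Change the colour of an element of the set in variable `14` if this is profitable. -/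
def improve : Cmd :=
  .branch (.natLt (entry 8 (var 14)) (.const 1)) (.seq search flip) .nop

theorem flip_runs_of_zero (hxv : μ.nat 16 0 0 = 0) {t : ℕ} {Q : Mem → Prop} (hQ : Q μ) :
    Runs flip μ (t + 2) Q := by
  obtain ⟨k, ν, he, hk, h⟩ := Runs.nop (t := 0) hQ
  exact ⟨1 + k, ν, .branchFalse (by simp [Test.Holds, NExp.eval, hxv]) he, by omega, h⟩

/-- `Laminar.exists_price_le` extends the result of the truncated search to all of `s`, and
`Laminar.price_eq_delta` turns prices into true cost changes. -/
theorem improve_runs (hF : F.Laminar) (hμ : F.Ready N h μ) (hp : F.Progress D μ)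
    (hc : F.Coloured N f μ) (hf : F.IsBest D f) (hD : F.Extends D s) (hsv : μ.nat 14 0 0 = s)
    (hrec : ∀ r < F.size, r ∉ D → μ.nat 9 r 0 = 0) :
    Runs improve μ (F.size * 10 + 16) fun ν => Frame [7, 8, 9, 13, 16] [3] μ ν ∧
      (∀ r < F.size, r ∉ insert s D → ν.nat 9 r 0 = 0) ∧
      ∃ g, F.IsBest (insert s D) g ∧ F.Coloured N g ν := by
  have hs := hD.new_lt_size
  refine (Runs.branch (t := F.size * 5 + 10 + (F.size * 5 + 5)) (fun hlt => ?_) fun hlt =>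
    Runs.nop ?_).mono (by omega) fun _ h => h
  · simp only [Test.Holds, NExp.eval, hsv, hc.wit s hs, Nat.lt_one_iff, witnesses_eq_zero] at hlt
    refine Runs.seq ((search_runs hμ hp hs hsv).mono le_rfl ?_)
    have hex := fun x hx => hF.exists_price_le (x := x) hD hf hlt (hμ.list_mem s hs)
      (hμ.list_inj s hs) hx
    have hpd := fun x hx => hF.price_eq_delta (x := x) hD hf hlt hx
    rintro ν ⟨hfr, ⟨h0, hle⟩ | ⟨x, hx, h16, hlt', hle⟩⟩
    · refine flip_runs_of_zero h0 ⟨hfr.weaken (by simp) (by simp), fun r hr hrD => ?_, f,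
        hF.isBest_keep hD hf hlt fun x hx => ?_, hc.frame hfr (by simp)⟩
      · rw [hfr.nat 9 (by simp)]
        exact hrec r hr fun h => hrD (Finset.mem_insert_of_mem h)
      · obtain ⟨i, hi, hi', hix⟩ := hex x hx
        rw [← hpd x hx]
        exact (hle i hi hi').trans hix
    · have h9 : ν.nat 9 = μ.nat 9 := hfr.nat 9 (by simp)
      refine (flip_runs (hμ.frame hfr (by simp) (by simp)) (hc.frame hfr (by simp)) hs
        (by rw [hfr.nat 14 (by simp), hsv]) hx (hlt x hx)
        (by rw [h9]; exact hrec s hs hD.notMem) h16).mono le_rfl ?_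
      rintro ξ ⟨hfr', hc', h9'⟩
      refine ⟨(hfr.weaken (by simp) (by simp)).trans (hfr'.weaken (by simp) (by simp)),
        fun r hr hrD => ?_, _, hF.isBest_flip hD hf hlt hx ?_ fun y hy => ?_, hc'⟩
      · rw [Finset.mem_insert, not_or] at hrD
        rw [h9' r hrD.1, h9]
        exact hrec r hr hrD.2
      · rw [← hpd x hx]
        exact hlt'.le
      · obtain ⟨i, hi, hi', hix⟩ := hex y hy
        rw [← hpd x hx, ← hpd y hy]
        exact (hle i hi hi').trans hix
  · simp only [Test.Holds, NExp.eval, hsv, hc.wit s hs, Nat.lt_one_iff, witnesses_eq_zero] at hlt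
    exact ⟨Frame.refl _ _ _, fun r hr hrD => hrec r hr fun h => hrD (Finset.mem_insert_of_mem h),
      f, hF.isBest_of_not_mono hD hf hlt, hc⟩

/-- Mark the set in variable `14` as finished and update the prices. -/
def finish : Cmd :=
  .seq (forLoop 13 (var 11)
      (.branch (.conj (natEq (entry 1 (var 13)) (.const 1))
          (.conj (.neg (natEq (entry 10 (var 13)) (entry 10 (var 14))))
            (.natLt (.const 0) (.get 3 (var 14) (.get 2 (var 13) (.const 0))))))
        (.storeReal 2 (entry 10 (var 14)) (.get 2 (var 13) (.const 0))
          (.sub (.get 2 (entry 10 (var 14)) (.get 2 (var 13) (.const 0)))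
            (.get 0 (var 14) (.const 0))))
        .nop))
    (.seq (.branch (natEq (entry 1 (var 14)) (.const 1))
        (.storeReal 2 (.sub (.const 1) (entry 10 (var 14))) (.get 2 (var 14) (.const 0))
          (.add (.get 2 (.sub (.const 1) (entry 10 (var 14))) (.get 2 (var 14) (.const 0)))
            (.get 0 (var 14) (.const 0))))
        .nop)
      (.storeNat 6 (var 14) (.const 0) (.const 1)))

theorem Stored.set_eq_singleton (hμ : F.Stored N h μ) (hs : s < F.size)
    (h1 : (F.set s).card = 1) : F.set s = {μ.nat 2 s 0} := by
  obtain ⟨x, hx⟩ := Finset.card_eq_one.1 h1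
  have := hμ.list_mem s hs 0 (by omega)
  rw [hx, Finset.mem_singleton] at this
  rw [hx, this]

-- The blocked elements of `s` are found by running through all singletons of the opposite kind,
-- which avoids a scan of `s`. The loop invariant is `price_insert` with `Blocked` restricted to the
-- indices already visited.
open Classical in
theorem finish_runs (hF : F.Laminar) (hμ : F.Ready N h μ) (hp : F.Progress D μ)
    (hD : F.Extends D s) (hsv : μ.nat 14 0 0 = s) :
    Runs finish μ (F.size * 4 + 5) fun ν => Frame [6, 13] [2] μ ν ∧
      F.Progress (insert s D) ν := by
  have hs := hD.new_lt_size
  refine Runs.mono (t₁ := (F.size * (2 + 2) + 2) + (2 + 1)) (Runs.seq ?_) (by omega) fun _ h => h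
  refine Runs.forLoop (Inv := fun i ν => Frame [6, 13] [2] μ ν ∧
    (∀ r < F.size, ν.nat 6 r 0 = if r ∈ D then 1 else 0) ∧
    ∀ c x, ν.real 2 c.toNat x = F.price D c x - if F.kind s = c ∧ x ∈ F.set s ∧
      (∃ u < i, F.kind u ≠ c ∧ F.set u = {x}) then F.weight s else 0) ?_ ?_ ?_ ?_ ?_
  · rintro i ν y ⟨hf, hb, hd⟩
    exact ⟨hf.setNat (by simp) _ _ _, by simpa using hb, by simpa using hd⟩
  · rintro i ν ⟨hf, _⟩
    exact (hμ.frame hf (by simp) (by simp)).size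
  · exact ⟨Frame.refl _ _ _, hp.done, by simpa using hp.price⟩
  · rintro i hi ν ⟨hf, hb, hd⟩ hvi
    have hS := hμ.frame hf (by simp) (by simp)
    have h14 : ν.nat 14 0 0 = s := by rw [hf.nat 14 (by simp), hsv]
    refine Runs.branch (t := 1) (fun hlt => Runs.storeReal ?_) fun hlt => Runs.nop ?_
    · simp only [Test.Holds, natEq_holds, NExp.eval, hvi, h14, hS.card i hi, hS.kinds i hi,
        hS.kinds s hs, toNat_inj] at hlt
      obtain ⟨h1, h2, h3⟩ := hlt
      have hset := hS.set_eq_singleton hi h1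
      have hxN := hS.lt i hi _ (hS.list_mem i hi 0 (by omega))
      set x := ν.nat 2 i 0 with hxdef
      rw [hS.table s hs x hxN] at h3
      have hxs : x ∈ F.set s := by
        by_contra hxs
        simp [hxs] at h3
      simp only [NExp.eval, RExp.eval, hvi, h14, hS.kinds s hs, hS.weight s hs, ← hxdef]
      refine ⟨by simpa using hvi, hf.setReal (by simp) _ _ _, by simpa using hb, fun c y => ?_⟩
      simp only [setReal_real_self, toNat_inj]
      by_cases hcy : c = F.kind s ∧ y = x
      · obtain ⟨rfl, rfl⟩ := hcy
        rw [if_pos ⟨rfl, rfl⟩, hd, if_neg, if_pos ⟨rfl, hxs, i, by omega, h2, hset⟩]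
        · ring
        -- Sets of one kind are distinct, so only one singleton blocks `x` and the weight is
        -- subtracted just once.
        · rintro ⟨-, -, u, hu, hk, hu'⟩
          have : F.kind u = F.kind i := by
            revert hk h2
            cases F.kind u <;> cases F.kind i <;> cases F.kind s <;> simp
          have := hF.distinct u (by omega) i hi this (by rw [hu', hset])
          omega
      · rw [if_neg hcy, hd]
        congr 1
        refine if_congr (and_congr_right fun hc => and_congr_right fun hy =>
          ⟨fun ⟨u, hu, h⟩ => ⟨u, by omega, h⟩, fun ⟨u, hu, h⟩ => ⟨u, ?_, h⟩⟩) rfl rfl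
        rcases eq_or_ne u i with rfl | hui
        · rw [hset, Finset.singleton_inj] at h
          exact absurd ⟨hc.symm, h.2.symm⟩ hcy
        · omega
    · refine ⟨hvi, hf, hb, fun c y => ?_⟩
      rw [hd]
      congr 1
      refine if_congr (and_congr_right fun hc => and_congr_right fun hy =>
        ⟨fun ⟨u, hu, h⟩ => ⟨u, by omega, h⟩, fun ⟨u, hu, h⟩ => ⟨u, ?_, h⟩⟩) rfl rfl
      rcases eq_or_ne u i with rfl | hui
      · exfalso
        apply hlt
        have h1 : (F.set u).card = 1 := by rw [h.2, Finset.card_singleton]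
        have hset := hS.set_eq_singleton hi h1
        rw [h.2, Finset.singleton_inj] at hset
        simp only [Test.Holds, natEq_holds, NExp.eval, hvi, h14, hS.card u hi, hS.kinds u hi,
          hS.kinds s hs, toNat_inj]
        refine ⟨h1, hc ▸ h.1, ?_⟩
        rw [← hset, hS.table s hs y (hS.lt s hs y hy), if_pos hy]
        exact one_pos
      · omega
  · rintro ν ⟨hf, hb, hd⟩
    have hS := hμ.frame hf (by simp) (by simp)
    have h14 : ν.nat 14 0 0 = s := by rw [hf.nat 14 (by simp), hsv]
    have hdone : ∀ ξ : Mem, ξ.nat 6 = ν.nat 6 → ∀ r < F.size,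
        (ξ.setNat 6 s 0 1).nat 6 r 0 = if r ∈ insert s D then 1 else 0 := fun ξ hξ r hr => by
      rw [setNat_nat_self, hξ, hb r hr]
      by_cases hrs : r = s <;> simp [hrs]
    -- If `s` is itself a singleton, the price of its element under the opposite colour rises by its
    -- weight; this is the positive term of `price_insert`.
    refine Runs.seq (Runs.branch (t := 1) (fun hlt => Runs.storeReal (Runs.storeNat (t := 0) ?_))
      fun hlt => Runs.nop (Runs.storeNat (t := 0) ?_))
    · simp only [natEq_holds, NExp.eval, h14, hS.card s hs] at hlt
      have hset := hS.set_eq_singleton hs hlt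
      simp only [NExp.eval, RExp.eval, h14, hS.kinds s hs, hS.weight s hs, setReal_nat,
        ← toNat_not]
      refine ⟨(hf.setReal (by simp) _ _ _).setNat (by simp) _ _ _, hdone _ (by simp),
        fun c x => ?_⟩
      simp only [setNat_real, setReal_real_self, toNat_inj, price_insert hD]
      by_cases hcx : c = (!F.kind s) ∧ x = ν.nat 2 s 0
      · obtain ⟨rfl, rfl⟩ := hcx
        rw [if_pos ⟨rfl, rfl⟩, hd, if_neg (by simp), if_pos ⟨by simp, hset⟩, if_neg (by simp)]
        ring
      · have hne : ¬ (F.kind s ≠ c ∧ F.set s = {x}) := by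
          rintro ⟨h1, h2⟩
          rw [hset, Finset.singleton_inj] at h2
          refine hcx ⟨?_, h2.symm⟩
          revert h1
          cases F.kind s <;> cases c <;> simp
        rw [if_neg hcx, hd, if_neg hne]
        simp only [Blocked]
        rw [zero_sub, ← sub_eq_add_neg]
        congr
    · simp only [natEq_holds, NExp.eval, h14, hS.card s hs] at hlt
      simp only [NExp.eval, h14]
      refine ⟨hf.setNat (by simp) _ _ _, hdone _ rfl, fun c x => ?_⟩
      have hne : ¬ (F.kind s ≠ c ∧ F.set s = {x}) := by
        rintro ⟨-, h2⟩
        rw [h2, Finset.card_singleton] at hlt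
        exact hlt rfl
      rw [setNat_real, price_insert hD, hd, if_neg hne]
      simp only [Blocked]
      rw [zero_sub, ← sub_eq_add_neg]
      congr

end SetSystem

/-! ### The main loop and the output -/

namespace SetSystem

open RAM

variable {F : SetSystem} {N h : ℕ} {μ ν : Mem} {D : Finset ℕ} {f : ℕ → Bool} {s : ℕ}

/-- Process all sets in an order of increasing cardinality. -/
def optimize : Cmd := forLoop 12 (var 11) (.seq select (.seq improve finish))

/-- The state of the main loop after the sets in `D` have been processed. -/
structure Processed (F : SetSystem) (N : ℕ) (D : Finset ℕ) (f : ℕ → Bool) (μ : Mem) : Prop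
    extends F.Coloured N f μ, F.Progress D μ, F.Initial D where
  best : F.IsBest D f
  unrecorded : ∀ r < F.size, r ∉ D → μ.nat 9 r 0 = 0

theorem Processed.frame {A B : List ℕ} (hμ : F.Processed N D f μ) (hf : Frame A B μ ν)
    (hA : ∀ a ∈ A, a ≠ 7 ∧ a ≠ 8 ∧ a ≠ 9) (h6 : 6 ∉ A) (hB : 2 ∉ B) : F.Processed N D f ν :=
  ⟨hμ.toColoured.frame hf hA, hμ.toProgress.frame hf h6 hB, hμ.toInitial, hμ.best, by
    rw [hf.nat 9 fun h => by have := hA 9 h; omega]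
    exact hμ.unrecorded⟩

theorem Initial.insert (hD : F.Initial D) (hs : F.Extends D s)
    (hmin : ∀ r < F.size, r ∉ D → (F.set s).card ≤ (F.set r).card) :
    F.Initial (insert s D) where
  lt_size r hr := by
    rcases Finset.mem_insert.1 hr with rfl | hr
    · exact hs.new_lt_size
    · exact hD.lt_size r hr
  card_le r hr q hq hqD := by
    rw [Finset.mem_insert, not_or] at hqD
    rcases Finset.mem_insert.1 hr with rfl | hr
    · exact hmin q hq hqD.2
    · exact hD.card_le r hr q hq hqD.2

theorem optimize_runs (hF : F.Laminar) (hμ : F.Ready N h μ) (hp : F.Processed N ∅ f μ) :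
    Runs optimize μ (F.size * (F.size * 19 + 26) + 2) fun ν =>
      Frame [6, 7, 8, 9, 12, 13, 14, 15, 16] [2, 3] μ ν ∧
      ∃ g, F.Processed N (Finset.range F.size) g ν := by
  -- The counter equals the cardinality of `D`, so after `F.size` rounds `D` contains every index.
  refine (Runs.forLoop (t := (F.size * 5 + 3) + ((F.size * 10 + 16) + (F.size * 4 + 5)))
    (Inv := fun i ν => Frame [6, 7, 8, 9, 12, 13, 14, 15, 16] [2, 3] μ ν ∧
    ∃ D g, D.card = i ∧ F.Processed N D g ν) (n := F.size) ?_ ?_ ?_ ?_ ?_).mono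
    (by apply le_of_eq; ring) fun _ h => h
  · rintro i ν y ⟨hf, D, g, hD, hP⟩
    exact ⟨hf.setNat (by simp) _ _ _, D, g, hD, hP.frame
      ((Frame.refl [12] [] ν).setNat (by simp) 0 0 y) (by simp) (by simp) (by simp)⟩
  · rintro i ν ⟨hf, _⟩
    exact (hμ.frame hf (by simp) (by simp)).size
  · exact ⟨Frame.refl _ _ _, ∅, f, rfl, hp⟩
  · rintro i hi ν ⟨hf, D, g, hD, hP⟩ hvi
    have hS := hμ.frame hf (by simp) (by simp)
    have hne : ∃ r < F.size, r ∉ D := by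
      obtain ⟨r, hr, hrD⟩ := Finset.exists_mem_notMem_of_card_lt_card
        (s := D) (t := Finset.range F.size) (by rw [Finset.card_range]; omega)
      exact ⟨r, Finset.mem_range.1 hr, hrD⟩
    refine Runs.seq ((select_runs hS hP.toProgress hP.toInitial hne).mono le_rfl ?_)
    rintro ν₁ ⟨hf₁, hE, hmin⟩
    have hS₁ := hS.frame hf₁ (by simp) (by simp)
    have hP₁ := hP.frame hf₁ (by simp) (by simp) (by simp)
    refine Runs.seq ((improve_runs hF hS₁ hP₁.toProgress hP₁.toColoured hP₁.best hE rfl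
      hP₁.unrecorded).mono le_rfl ?_)
    rintro ν₂ ⟨hf₂, hrec, g', hbest, hc⟩
    have hS₂ := hS₁.frame hf₂ (by simp) (by simp)
    have hP₂ := hP₁.toProgress.frame hf₂ (by simp) (by simp)
    refine (finish_runs hF hS₂ hP₂ hE (by rw [hf₂.nat 14 (by simp)])).mono le_rfl ?_
    rintro ν₃ ⟨hf₃, hP₃⟩
    refine ⟨?_, ?_, _, g', ?_, hc.frame hf₃ (by simp), hP₃, hP.toInitial.insert hE hmin, hbest, ?_⟩
    · rw [hf₃.nat 12 (by simp), hf₂.nat 12 (by simp), hf₁.nat 12 (by simp), hvi]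
    · exact ((hf.trans (hf₁.weaken (by simp) (by simp))).trans
        (hf₂.weaken (by simp) (by simp))).trans (hf₃.weaken (by simp) (by simp))
    · rw [Finset.card_insert_of_notMem hE.notMem, hD]
    · rw [hf₃.nat 9 (by simp)]
      exact hrec
  · rintro ν ⟨hf, D, g, hD, hP⟩
    have : D = Finset.range F.size := Finset.eq_of_subset_of_card_le
      (fun r hr => Finset.mem_range.2 (hP.lt_size r hr)) (by rw [Finset.card_range, hD])
    exact ⟨hf, g, this ▸ hP⟩

theorem toNat_pos {c : Bool} : 0 < c.toNat ↔ c = true := by cases c <;> simp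

/-- The contribution of the set `r` to the profit of a colouring. -/
def gain (F : SetSystem) (f : ℕ → Bool) (r : ℕ) : ℝ :=
  if F.kind r then (if F.Mono f r then -F.weight r else 0)
  else if F.Mono f r then 0 else F.weight r

/-- Compute the profit. -/
def evaluate : Cmd :=
  forLoop 13 (var 11)
    (.branch (.natLt (.const 0) (entry 10 (var 13)))
      (.branch (.natLt (entry 8 (var 13)) (.const 1))
        (.storeReal 1 (.const 0) (.const 0)
          (.sub (.get 1 (.const 0) (.const 0)) (.get 0 (var 13) (.const 0))))
        .nop)
      (.branch (.natLt (entry 8 (var 13)) (.const 1))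
        .nop
        (.storeReal 1 (.const 0) (.const 0)
          (.add (.get 1 (.const 0) (.const 0)) (.get 0 (var 13) (.const 0))))))

theorem evaluate_runs (hμ : F.Ready N h μ) (hc : F.Coloured N f μ) (h0 : μ.real 1 0 0 = 0) :
    Runs evaluate μ (F.size * 5 + 2) fun ν => Frame [13] [1] μ ν ∧
      ν.real 1 0 0 = ∑ r ∈ Finset.range F.size, F.gain f r := by
  refine Runs.forLoop (t := 3) (Inv := fun i ν => Frame [13] [1] μ ν ∧
    ν.real 1 0 0 = ∑ r ∈ Finset.range i, F.gain f r) ?_ ?_ ?_ ?_ ?_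
  · rintro i ν y ⟨hf, hb⟩
    exact ⟨hf.setNat (by simp) _ _ _, hb⟩
  · rintro i ν ⟨hf, _⟩
    exact (hμ.frame hf (by simp) (by simp)).size
  · exact ⟨Frame.refl _ _ _, by simpa using h0⟩
  · rintro i hi ν ⟨hf, hb⟩ hvi
    have hS := hμ.frame hf (by simp) (by simp)
    have hC := hc.frame hf (by simp)
    have hset : ∀ v, v = ν.real 1 0 0 + F.gain f i → (ν.setReal 1 0 0 v).nat 13 0 0 = i ∧
        Frame [13] [1] μ (ν.setReal 1 0 0 v) ∧
        (ν.setReal 1 0 0 v).real 1 0 0 = ∑ r ∈ Finset.range (i + 1), F.gain f r := by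
      rintro v rfl
      refine ⟨hvi, hf.setReal (by simp) _ _ _, ?_⟩
      rw [Finset.sum_range_succ, ← hb]
      simp
    have hkeep : F.gain f i = 0 → ν.nat 13 0 0 = i ∧ Frame [13] [1] μ ν ∧
        ν.real 1 0 0 = ∑ r ∈ Finset.range (i + 1), F.gain f r := fun h =>
      ⟨hvi, hf, by rw [Finset.sum_range_succ, h, add_zero, hb]⟩
    refine Runs.branch (t := 2) (fun hk => Runs.branch (t := 1) (fun hm => ?_) fun hm => ?_)
      fun hk => Runs.branch (t := 1) (fun hm => ?_) fun hm => ?_ <;>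
    simp only [Test.Holds, NExp.eval, hvi, hS.kinds i hi, hC.wit i hi, Nat.lt_one_iff,
      witnesses_eq_zero, toNat_pos] at hk hm
    · refine Runs.storeReal ?_
      simp only [NExp.eval, RExp.eval, hvi, hS.weight i hi]
      exact hset _ (by simp [gain, hk, hm, sub_eq_add_neg])
    · exact Runs.nop (hkeep (by simp [gain, hk, hm]))
    · exact Runs.nop (hkeep (by simp [gain, hk, hm]))
    · refine Runs.storeReal ?_
      simp only [NExp.eval, RExp.eval, hvi, hS.weight i hi]
      exact hset _ (by simp [gain, hk, hm])
  · exact fun ν h => h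

/-- List the elements of the colour `true`, which loses its entries in array `7`. -/
def collect : Cmd :=
  forLoop 13 (var 11)
    (.branch (.conj (.natLt (.const 0) (entry 9 (var 13)))
        (.natLt (.const 0) (entry 7 (.sub (entry 9 (var 13)) (.const 1)))))
      (.seq (.storeNat 5 (.const 0) (var 4) (.sub (entry 9 (var 13)) (.const 1)))
        (.seq (.storeNat 4 (.const 0) (.const 0) (.add (var 4) (.const 1)))
          (.storeNat 7 (.sub (entry 9 (var 13)) (.const 1)) (.const 0) (.const 0))))
      .nop)

/-- Scanning the records instead of the players keeps the time linear in the number of sets. A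
record may be stale or repeat a player; the colour test rejects the former, and clearing the colour
on output rejects the latter. -/
theorem collect_runs (hμ : F.Ready N h μ) (hc : F.Coloured N f μ) (h0 : μ.nat 4 0 0 = 0) :
    Runs collect μ (F.size * 6 + 2) fun ν => Frame [4, 5, 7, 13] [] μ ν ∧
      ∃ Y : Finset ℕ, (∀ x, x ∈ Y ↔ f x = true) ∧ (∀ x ∈ Y, x < N) ∧ ν.nat 4 0 0 = Y.card ∧
        (∀ k < Y.card, ν.nat 5 0 k ∈ Y) ∧ Set.InjOn (ν.nat 5 0) (Set.Iio Y.card) := by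
  refine Runs.forLoop (t := 4) (Inv := fun i ν => Frame [4, 5, 7, 13] [] μ ν ∧
    ∃ Y : Finset ℕ, (∀ x ∈ Y, f x = true) ∧
      (∀ j < i, ∀ x, μ.nat 9 j 0 = x + 1 → f x = true → x ∈ Y) ∧ ν.nat 4 0 0 = Y.card ∧
      (∀ k < Y.card, ν.nat 5 0 k ∈ Y) ∧ Set.InjOn (ν.nat 5 0) (Set.Iio Y.card) ∧
      ∀ x < N, ν.nat 7 x 0 = if f x = true ∧ x ∉ Y then 1 else 0) ?_ ?_ ?_ ?_ ?_
  · rintro i ν y ⟨hf, Y, h1, h2, h3, h4, h5, h6⟩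
    exact ⟨hf.setNat (by simp) _ _ _, Y, h1, h2, by simpa using h3, by simpa using h4,
      by simpa using h5, by simpa using h6⟩
  · rintro i ν ⟨hf, _⟩
    exact (hμ.frame hf (by simp) (by simp)).size
  · refine ⟨Frame.refl _ _ _, ∅, by simp, by simp, h0, by simp, by simp, fun x hx => ?_⟩
    rw [hc.color x hx]
    cases f x <;> simp
  · rintro i hi ν ⟨hf, Y, h1, h2, h3, h4, h5, h6⟩ hvi
    have h9 : ν.nat 9 = μ.nat 9 := hf.nat 9 (by simp)
    refine Runs.branch (t := 3) (fun hlt => ?_) fun hlt => Runs.nop ?_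
    · simp only [Test.Holds, NExp.eval, hvi, h9] at hlt
      obtain ⟨x, hx⟩ := Nat.exists_eq_succ_of_ne_zero hlt.1.ne'
      rw [Nat.succ_eq_add_one] at hx
      have hxN := hμ.lt i hi x (hc.record_mem i hi x hx)
      rw [hx, Nat.add_sub_cancel, h6 x hxN] at hlt
      obtain ⟨hfx, hxY⟩ : f x = true ∧ x ∉ Y := by
        by_contra hn
        simp [hn] at hlt
      refine Runs.seq (Runs.storeNat (t := 0) (Runs.seq (Runs.storeNat (t := 0)
        (Runs.storeNat (t := 0) ?_))))
      have hval : ∀ ξ : Mem, ξ.nat 13 = ν.nat 13 → ξ.nat 9 = μ.nat 9 →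
          NExp.eval ξ (.sub (entry 9 (var 13)) (.const 1)) = x := fun ξ e₁ e₂ => by
        simp [NExp.eval, e₁, e₂, hvi, hx]
      rw [hval ν rfl h9, hval _ (by simp) (by simp [h9])]
      simp only [NExp.eval, h3]
      have hcard := Finset.card_insert_of_notMem hxY
      refine ⟨by simpa using hvi, ((hf.setNat (by simp) _ _ _).setNat (by simp) _ _ _).setNat
        (by simp) _ _ _, insert x Y, by simpa [hfx] using h1, fun j hj y hy hfy => ?_, ?_, ?_, ?_, ?_⟩
      · rw [Finset.mem_insert]
        rcases eq_or_ne j i with rfl | hji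
        · left; omega
        · exact .inr (h2 j (by omega) y hy hfy)
      · simp [hcard, h3]
      · intro k hk
        rw [hcard] at hk
        rcases eq_or_ne k Y.card with rfl | hk'
        · simp
        · simp [hk', h4 k (by omega)]
      · have hval5 : ∀ k, (((ν.setNat 5 0 Y.card x).setNat 4 0 0
            ((ν.setNat 5 0 Y.card x).nat 4 0 0 + 1)).setNat 7 x 0 0).nat 5 0 k =
            if k = Y.card then x else ν.nat 5 0 k := fun k => by simp
        intro j hj k hk hjk
        rw [Set.mem_Iio, hcard] at hj hk
        rw [hval5, hval5] at hjk
        split_ifs at hjk with hj' hk' hk'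
        · omega
        · exact absurd (hjk ▸ h4 k (by omega)) hxY
        · exact absurd (hjk ▸ h4 j (by omega)) hxY
        · exact h5 (Set.mem_Iio.2 (by omega)) (Set.mem_Iio.2 (by omega)) hjk
      · intro y hy
        rcases eq_or_ne y x with rfl | hyx
        · simp
        · simp [hyx, h6 y hy]
    · simp only [Test.Holds, NExp.eval, hvi, h9] at hlt
      refine ⟨hvi, hf, Y, h1, fun j hj y hy hfy => ?_, h3, h4, h5, h6⟩
      rcases eq_or_ne j i with rfl | hji
      · by_contra hyY
        have hyN := hμ.lt j hi y (hc.record_mem j hi y hy)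
        rw [hy, Nat.add_sub_cancel, h6 y hyN, if_pos ⟨hfy, hyY⟩] at hlt
        exact hlt ⟨by omega, one_pos⟩
      · exact h2 j (by omega) y hy hfy
  · rintro ν ⟨hf, Y, h1, h2, h3, h4, h5, -⟩
    refine ⟨hf, Y, fun x => ⟨h1 x, fun hx => ?_⟩, fun x hx => ?_, h3, h4, h5⟩
    · obtain ⟨s, hs, hsx⟩ := hc.recorded x hx
      exact h2 s hs x hsx hx
    · obtain ⟨s, hs, hsx⟩ := hc.recorded x (h1 x hx)
      exact hμ.lt s hs x (hc.record_mem s hs x hsx)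

/-- The complete algorithm. -/
def solve : Cmd := .seq setup (.seq optimize (.seq evaluate collect))

theorem solve_runs (hF : F.Laminar) (hμ : F.Stored N h μ) (hn : ∀ a i j, 4 ≤ a → μ.nat a i j = 0)
    (hr : ∀ a i j, 1 ≤ a → μ.real a i j = 0) :
    Runs solve μ (50 * (F.size + 1) ^ 2) fun ν =>
      ∃ f, F.IsBest (Finset.range F.size) f ∧
        ν.real 1 0 0 = ∑ r ∈ Finset.range F.size, F.gain f r ∧
        ∃ Y : Finset ℕ, (∀ x, x ∈ Y ↔ f x = true) ∧ (∀ x ∈ Y, x < N) ∧ ν.nat 4 0 0 = Y.card ∧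
          (∀ k < Y.card, ν.nat 5 0 k ∈ Y) ∧ Set.InjOn (ν.nat 5 0) (Set.Iio Y.card) := by
  -- With K sets the phases add up to 19K² + 42K + 9 steps.
  refine Runs.mono (t₁ := (F.size * 5 + 3) + ((F.size * (F.size * 19 + 26) + 2) +
    ((F.size * 5 + 2) + (F.size * 6 + 2)))) (Runs.seq ((setup_runs hμ
      (fun r => hn _ _ _ (by omega)) (fun r => hn _ _ _ (by omega))).mono le_rfl ?_))
    (by nlinarith) fun _ h => h
  rintro ν ⟨hf, hS, hw⟩
  have h7 : ν.nat 7 = μ.nat 7 := hf.nat 7 (by simp)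
  have h9 : ν.nat 9 = μ.nat 9 := hf.nat 9 (by simp)
  have h6 : ν.nat 6 = μ.nat 6 := hf.nat 6 (by simp)
  have h2 : ν.real 2 = μ.real 2 := hf.real 2 (by simp)
  have hP : F.Processed N ∅ (fun _ => false) ν := by
    refine ⟨⟨fun x _ => ?_, hw, by simp, fun s _ x hx => ?_⟩, ⟨fun r _ => ?_, fun c x => ?_⟩,
      ⟨by simp, by simp⟩, fun g => ?_, fun r _ _ => ?_⟩
    · rw [h7, hn _ _ _ (by omega)]; rfl
    · rw [h9, hn _ _ _ (by omega)] at hx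
      omega
    · rw [h6, hn _ _ _ (by omega)]; simp
    · rw [h2, hr _ _ _ (by omega)]; simp [price, delta]
    · simp [cost]
    · rw [h9, hn _ _ _ (by omega)]
  refine Runs.seq ((optimize_runs hF hS hP).mono le_rfl ?_)
  rintro ν₁ ⟨hf₁, f, hP₁⟩
  have hS₁ := hS.frame hf₁ (by simp) (by simp)
  refine Runs.seq ((evaluate_runs hS₁ hP₁.toColoured ?_).mono le_rfl ?_)
  · rw [hf₁.real 1 (by simp), hf.real 1 (by simp), hr _ _ _ (by omega)]
  rintro ν₂ ⟨hf₂, hsum⟩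
  refine (collect_runs (hS₁.frame hf₂ (by simp) (by simp)) (hP₁.toColoured.frame hf₂ (by simp))
    ?_).mono le_rfl ?_
  · rw [hf₂.nat 4 (by simp), hf₁.nat 4 (by simp), hf.nat 4 (by simp), hn _ _ _ (by omega)]
  rintro ν₃ ⟨hf₃, hY⟩
  exact ⟨f, hP₁.best, by rw [hf₃.real 1 (by simp), hsum], hY⟩

end SetSystem

/-! ## Reward-penalty-selection instances as set systems -/

namespace RPSP

open SetSystem RAM

variable {N h l : ℕ} (I : RPSP N h l)

/-- The reward sets and the penalty sets as a set system. -/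
def system : SetSystem where
  size := h + l
  set r := if hr : r < h then (I.rewardSet ⟨r, hr⟩).map Fin.valEmbedding
    else if hr' : r - h < l then (I.penaltySet ⟨r - h, hr'⟩).map Fin.valEmbedding else ∅
  kind r := decide (h ≤ r)
  weight r := if hr : r < h then I.reward ⟨r, hr⟩
    else if hr' : r - h < l then I.penalty ⟨r - h, hr'⟩ else 0

/-- The players of the colour `true`. -/
def selection (f : ℕ → Bool) : Finset (Fin N) := Finset.univ.filter fun x => f x = true

@[simp] theorem system_size : I.system.size = h + l := rfl

@[simp] theorem system_kind (r : ℕ) : I.system.kind r = decide (h ≤ r) := rfl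

theorem system_set_row (s : Fin h ⊕ Fin l) :
    I.system.set (row s) = (I.member s).map Fin.valEmbedding := by
  rcases s with i | j <;> simp [system, row, member]

theorem system_weight_inl (i : Fin h) : I.system.weight i = I.reward i := by
  simp [system]

theorem system_weight_inr (j : Fin l) : I.system.weight (h + j) = I.penalty j := by
  simp [system]

theorem exists_row {r : ℕ} (hr : r < h + l) : ∃ s : Fin h ⊕ Fin l, row s = r := by
  by_cases hrh : r < h
  · exact ⟨.inl ⟨r, hrh⟩, rfl⟩
  · exact ⟨.inr ⟨r - h, by omega⟩, by simp only [row]; omega⟩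

variable {I}

theorem IsLaminar.system (hI : I.IsLaminar) : I.system.Laminar where
  weight_nonneg r := by
    simp only [RPSP.system]
    split_ifs
    exacts [I.reward_nonneg _, I.penalty_nonneg _, le_rfl]
  distinct r hr s hs hk hset := by
    obtain ⟨u, rfl⟩ := exists_row hr
    obtain ⟨v, rfl⟩ := exists_row hs
    rw [system_set_row, system_set_row, Finset.map_inj] at hset
    simp only [system_kind, decide_eq_decide] at hk
    rcases u with i | i <;> rcases v with j | j
    · rw [hI.reward_distinct hset]
    · simp only [row] at hk
      have := i.2
      omega
    · simp only [row] at hk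
      have := j.2
      omega
    · rw [hI.penalty_distinct hset]
  nested r hr s hs := by
    obtain ⟨u, rfl⟩ := exists_row hr
    obtain ⟨v, rfl⟩ := exists_row hs
    rw [system_set_row, system_set_row, Finset.map_subset_map, Finset.map_subset_map,
      Finset.disjoint_map, Finset.disjoint_iff_inter_eq_empty]
    exact hI.laminar u v

theorem StoredIn.system {μ : Mem} (hμ : I.StoredIn μ) : I.system.Stored N h μ := by
  refine ⟨hμ.numPlayers, hμ.numRewards, by rw [hμ.numPenalties]; rfl, fun r hr => ?_,
    fun r hr i hi => ?_, fun r hr => ?_, fun r hr x hx => ?_, fun r hr => ?_, fun r _ => rfl,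
    fun r hr x hx => ?_⟩ <;> obtain ⟨s, rfl⟩ := exists_row hr
  · rw [hμ.card, system_set_row, Finset.card_map]
  · rw [system_set_row, Finset.card_map] at hi
    obtain ⟨e, he⟩ := hμ.list s
    rw [system_set_row, he ⟨i, hi⟩]
    exact Finset.mem_map_of_mem Fin.valEmbedding (e ⟨i, hi⟩).2
  · rw [system_set_row, Finset.card_map]
    obtain ⟨e, he⟩ := hμ.list s
    intro i hi j hj hij
    have h1 := he ⟨i, hi⟩
    have h2 := he ⟨j, hj⟩
    simp only at h1 h2
    rw [h1, h2] at hij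
    exact congrArg Fin.val (e.injective (Subtype.ext (Fin.ext hij)))
  · rw [system_set_row, hμ.table s ⟨x, hx⟩]
    refine if_congr ?_ rfl rfl
    simp [Fin.exists_iff, hx]
  · rcases s with i | j
    · rw [hμ.reward, row, system_weight_inl]
    · rw [hμ.penalty, row, system_weight_inr]
  · rw [system_set_row, Finset.mem_map] at hx
    obtain ⟨y, -, rfl⟩ := hx
    exact y.2

/-! ### Translation between profit and cost -/

theorem mono_inl {f : ℕ → Bool} {i : Fin h} :
    I.system.Mono f i ↔ ¬ (I.rewardSet i ∩ selection f).Nonempty := by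
  have := I.system_set_row (.inl i)
  simp only [row, member, Sum.elim_inl] at this
  simp [Mono, this, Finset.Nonempty, selection, not_le.2 i.2]

theorem mono_inr {f : ℕ → Bool} {j : Fin l} :
    I.system.Mono f (h + j) ↔ I.penaltySet j ⊆ selection f := by
  have := I.system_set_row (.inr j)
  simp only [row, member, Sum.elim_inr] at this
  simp [Mono, this, selection, Finset.subset_iff]

theorem sum_gain (f : ℕ → Bool) :
    ∑ r ∈ Finset.range I.system.size, I.system.gain f r = I.profit (selection f) := by
  rw [system_size, Finset.sum_range_add, Finset.sum_range, Finset.sum_range, profit,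
    sub_eq_add_neg, ← Finset.sum_neg_distrib, Finset.sum_filter, Finset.sum_filter]
  congr 1 <;> refine Finset.sum_congr rfl fun i _ => ?_
  · simp only [gain, mono_inl, system_kind, decide_eq_true_eq, not_le.2 i.2, if_false,
      system_weight_inl]
    split_ifs <;> rfl
  · simp only [gain, mono_inr, system_kind, decide_eq_true_eq, Nat.le_add_right, if_true,
      system_weight_inr]

/-- Relative to collecting all rewards, an unhit reward set loses its reward and a covered penalty
set its penalty; these losses form the cost, so minimal cost means maximal profit. -/
theorem profit_selection (f : ℕ → Bool) :
    I.profit (selection f) =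
      ∑ i, I.reward i - I.system.cost (Finset.range I.system.size) f := by
  rw [← sum_gain, cost, system_size, Finset.sum_range_add, Finset.sum_range_add,
    Finset.sum_range, Finset.sum_range, Finset.sum_range, Finset.sum_range, ← sub_sub,
    ← Finset.sum_sub_distrib, sub_eq_add_neg, ← Finset.sum_neg_distrib]
  congr 1 <;> refine Finset.sum_congr rfl fun i _ => ?_
  · simp only [gain, system_kind, decide_eq_true_eq, not_le.2 i.2, if_false, system_weight_inl]
    split_ifs <;> simp
  · simp only [gain, system_kind, decide_eq_true_eq, Nat.le_add_right, if_true]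
    split_ifs <;> simp

theorem exists_selection (Y : Finset (Fin N)) : ∃ f, selection f = Y := by
  classical
  refine ⟨fun x => decide (∃ hx : x < N, (⟨x, hx⟩ : Fin N) ∈ Y), ?_⟩
  ext x
  simp [selection]

theorem isOptimal_selection {f : ℕ → Bool}
    (hf : I.system.IsBest (Finset.range I.system.size) f) : I.IsOptimal (selection f) := fun Y => by
  obtain ⟨g, rfl⟩ := exists_selection Y
  rw [profit_selection, profit_selection]
  exact sub_le_sub_left (hf g) _

theorem lists_of_injOn {r : ℕ → ℕ} {X : Finset (Fin N)}
    (hmem : ∀ k < X.card, r k ∈ X.map Fin.valEmbedding) (hinj : Set.InjOn r (Set.Iio X.card)) :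
    Lists r X := by
  have hex : ∀ k : Fin X.card, ∃ x : X, ((x : Fin N) : ℕ) = r k := fun k => by
    obtain ⟨x, hx, hxk⟩ := Finset.mem_map.1 (hmem k k.2)
    exact ⟨⟨x, hx⟩, hxk⟩
  choose e he using hex
  have hbij : Function.Bijective e := by
    rw [Fintype.bijective_iff_injective_and_card]
    refine ⟨fun i j hij => Fin.ext (hinj i.2 j.2 ?_), by simp⟩
    rw [← he, ← he, hij]
  exact ⟨Equiv.ofBijective e hbij, fun k => (he k).symm⟩

/-- The laminar problem can be solved in quadratic time in the number of sets. -/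
theorem IsLaminar.solve_runs (hI : I.IsLaminar) {μ : Mem} (hμ : I.StoredIn μ) :
    Runs SetSystem.solve μ (50 * (h + l + 1) ^ 2) I.SolvedIn := by
  refine (SetSystem.solve_runs hI.system hμ.system hμ.natZero hμ.realZero).mono le_rfl ?_
  rintro ν ⟨f, hf, hp, Y, hY, hlt, hcard, hmem, hinj⟩
  have hYX : Y = (selection (N := N) f).map Fin.valEmbedding := by
    ext x
    rw [Finset.mem_map]
    constructor
    · exact fun hx => ⟨⟨x, hlt x hx⟩, by simpa [selection] using (hY x).1 hx, rfl⟩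
    · rintro ⟨y, hy, rfl⟩
      exact (hY y).2 (by simpa [selection] using hy)
  subst hYX
  rw [Finset.card_map] at hcard hmem hinj
  exact ⟨selection f, isOptimal_selection hf, hcard, lists_of_injOn hmem hinj,
    by rw [hp, sum_gain]⟩

/-! ### The number of sets against the containment graph -/

open Classical in
theorem exists_top_node (I : RPSP N h l) :
    ∃ u ∈ I.nodes, ∀ v ∈ I.nodes, I.nodeSet v ⊆ I.nodeSet u := by
  by_cases hr : I.HasRoot
  · have ⟨s, hs⟩ := hr
    refine ⟨some s, by simp [nodes, hr], fun v hv => ?_⟩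
    cases v with
    | none => simp [nodes, hr] at hv
    | some t => exact hs t
  · exact ⟨none, by simp [nodes, hr], fun v _ => Finset.subset_univ _⟩

/-- A node whose set contains all the others, the artificial root if necessary, has an edge to every
other node. -/
theorem numNodes_le (I : RPSP N h l) : I.numNodes ≤ I.numEdges + 1 := by
  classical
  obtain ⟨u, hu, hmax⟩ := I.exists_top_node
  have hle : ((I.nodes.erase u).image fun v => (u, v)).card ≤ I.edges.card := by
    refine Finset.card_le_card fun p hp => ?_
    obtain ⟨v, hv, rfl⟩ := Finset.mem_image.1 hp
    obtain ⟨hvu, hv⟩ := Finset.mem_erase.1 hv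
    simp only [edges, Finset.mem_filter, Finset.mem_product]
    exact ⟨⟨hu, hv⟩, hvu.symm, hmax v hv⟩
  rw [Finset.card_image_of_injective _ (Prod.mk_right_injective u),
    Finset.card_erase_of_mem hu] at hle
  unfold numNodes numEdges
  omega

theorem size_le_numNodes (I : RPSP N h l) : h + l ≤ I.numNodes := by
  classical
  unfold numNodes nodes
  split_ifs <;> simp

theorem sq_size_le (I : RPSP N h l) {T : ℕ} (hT : 1 ≤ T) :
    (h + l + 1) ^ 2 ≤ 4 * (I.numEdges * (I.numNodes + I.numEdges) + T) := by
  have h1 := I.numNodes_le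
  have h2 := I.size_le_numNodes
  generalize h + l = K at *
  generalize I.numNodes = n at *
  generalize I.numEdges = m at *
  rcases Nat.eq_zero_or_pos m with rfl | hm
  -- Without edges there is at most one set, and 4T with T ≥ 1 bounds (1 + 1)²; this case dictates
  -- the factor 4.
  · have : K ≤ 1 := by omega
    nlinarith
  · have : K + 1 ≤ m + 2 := by omega
    nlinarith [Nat.mul_le_mul_left m h2, Nat.mul_le_mul this this]

end RPSP

theorem mainTheorem4 (T_MF : ℕ → ℕ → ℕ)
    (hT : IsMaxFlowTime T_MF ∨ IsMaxProfitCirculationTime T_MF) :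
    ∃ (P : RAM.Cmd) (C : ℕ), ∀ (N h l : ℕ) (I : RPSP N h l), I.IsLaminar →
      ∀ μ : RAM.Mem, I.StoredIn μ →
        ∃ (k : ℕ) (μ' : RAM.Mem), RAM.Exec P μ k μ' ∧ I.SolvedIn μ' ∧
          k ≤ C * (I.numEdges * (I.numNodes + I.numEdges) + T_MF I.numNodes I.numEdges) := by
  have hpos : ∀ n m, 1 ≤ T_MF n m := hT.elim And.left And.left
  -- The constant is 50 from the running time times 4 from `RPSP.sq_size_le`.
  refine ⟨SetSystem.solve, 200, fun N h l I hI μ hμ => ?_⟩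
  obtain ⟨k, μ', hexec, hk, hsol⟩ := hI.solve_runs hμ
  have := I.sq_size_le (hpos I.numNodes I.numEdges)
  exact ⟨k, μ', hexec, hsol, by omega⟩
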